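/- Let $n\ge 0$, let $\lambda=(\lambda_1\ge\cdots\ge\lambda_n\ge 0)$ be a partition of length at most $n$, let $\delta=(n,n-1,\ldots,1)$ and let $\mu=\lambda+\delta$, a strict partition of length $n$. Let $\mathbf x=(x_1,\ldots,x_n)$, $\mathbf y=(y_1,\ldots,y_n)$ be invertible commuting variables and $t$ a further commuting variable. *Tableaux.* Let $F^\lambda$ be the Young diagram of $\lambda$. Let $SF^\mu$ be the shifted Young diagram of $\mu$, in which row $i$ has $\mu_i$ boxes and begins in column $i$. * $\mathcal T^\lambda(n,\overline n)$ is the set of fillings of $F^\lambda$ with entries from $\overline 1<1<\overline 2<2<\cdots<\overline n<n$ that are weakly increasing along rows, strictly increasing down columns, and in which $k$ and $\overline k$ appear no lower than row $k$. * $\mathcal{QST}^\mu(n,\overline n)$ is the set of fillings of $SF^\mu$ with entries from $\overline 1'<\overline 1<1'<1<\cdots<\overline n'<\overline n<n'<n$ that are weakly increasing along rows and down columns, have no two identical unprimed entries in any column and no two identical primed entries in any row, and whose $k$-th main-diagonal entry lies in $\{\overline k',\overline k,k',k\}$ for each $k$. * $\mathcal{QD}^\delta(n,\overline n)$ is the set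 of all fillings of $SF^\delta$ with entries from the same primed alphabet such that each unprimed entry $k$ or $\overline k$ lies in row $k$ and each primed entry $k'$ or $\overline k'$ lies in column $k$. *Weights.* Write $n_a$ for the number of occurrences of the letter $a$ in a filling, and let $\mathrm{bar}$ be the total number of its barred entries (primed or not). For $T\in\mathcal T^\lambda(n,\overline n)$ put $\mathbf x^{\mathrm{wgt}(T)}=\prod_k x_k^{\,n_k-n_{\overline k}}$. For a primed filling $S$ put $(\mathbf x/\mathbf y)^{\mathrm{wgt}(S)}=\prod_k x_k^{\,n_k-n_{\overline k}}\,y_k^{\,n_{k'}-n_{\overline k'}}$. Define $$sp_\lambda(\mathbf x;t)=\sum_{T\in\mathcal T^\lambda(n,\overline n)}t^{2\,\mathrm{bar}(T)}\,\mathbf x^{\mathrm{wgt}(T)},\qquad Q_\mu(\mathbf x/\mathbf y;t)=\sum_{S\in\mathcal{QST}^\mu(n,\overline n)}t^{2\,\mathrm{bar}(S)}\,(\mathbf x/\mathbf y)^{\mathrm{wgt}(S)}.$$ *Claim.* Then $$Q_\mu(\mathbf x/\mathbf y;t)=sp_\lambda(\mathbf x;t)\prod_{1\le i\le j\le n}\bigl(x_i+t^2x_i^{-1}+y_j+t^2y_j^{-1}\bigr),$$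 and, equivalently, $$\sum_{S\in\mathcal{QST}^\mu(n,\overline n)}t^{2\,\mathrm{bar}(S)}(\mathbf x/\mathbf y)^{\mathrm{wgt}(S)}=\sum_{D\in\mathcal{QD}^\delta(n,\overline n)}t^{2\,\mathrm{bar}(D)}(\mathbf x/\mathbf y)^{\mathrm{wgt}(D)}\;\sum_{T\in\mathcal T^\lambda(n,\overline n)}t^{2\,\mathrm{bar}(T)}\mathbf x^{\mathrm{wgt}(T)}.$$ -/

import Mathlib

namespace SymplecticTableaux

/-- A letter `k` (unbarred) or `k̄` (barred), `k = 1, …, n`. The index `k` is stored as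
`idx : Fin n`, so that `idx = 0` stands for `k = 1`. -/
@[ext]
structure Letter (n : ℕ) where
  idx : Fin n
  barred : Bool
deriving DecidableEq, Fintype

/-- Position of a letter in the order `1̄ < 1 < 2̄ < 2 < ⋯ < n̄ < n`. -/
def Letter.rank {n : ℕ} (a : Letter n) : ℕ :=
  2 * a.idx.val + (if a.barred then 0 else 1)

theorem Letter.rank_injective {n : ℕ} : Function.Injective (Letter.rank (n := n)) := by
  rintro ⟨i, b⟩ ⟨j, c⟩ h
  cases b <;> cases c <;> simp [Letter.rank] at h <;>
    first
      | omega
      | (simp; omega)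

instance (n : ℕ) : LinearOrder (Letter n) :=
  LinearOrder.lift' Letter.rank Letter.rank_injective

/-- A letter `k`, `k̄`, `k'` or `k̄'`, `k = 1, …, n` (with `k` stored as `idx : Fin n`). -/
@[ext]
structure PrimedLetter (n : ℕ) where
  idx : Fin n
  barred : Bool
  primed : Bool
deriving DecidableEq, Fintype

/-- Position of a letter in the order `1̄' < 1̄ < 1' < 1 < 2̄' < 2̄ < 2' < 2 < ⋯ < n̄' < n̄ < n' < n`. -/
def PrimedLetter.rank {n : ℕ} (a : PrimedLetter n) : ℕ :=
  4 * a.idx.val + (if a.barred then 0 else 2) + (if a.primed then 0 else 1)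

theorem PrimedLetter.rank_injective {n : ℕ} :
    Function.Injective (PrimedLetter.rank (n := n)) := by
  rintro ⟨i, b, p⟩ ⟨j, c, q⟩ h
  cases b <;> cases c <;> cases p <;> cases q <;> simp [PrimedLetter.rank] at h <;>
    first
      | omega
      | (simp; omega)

instance (n : ℕ) : LinearOrder (PrimedLetter n) :=
  LinearOrder.lift' PrimedLetter.rank PrimedLetter.rank_injective

/-- The boxes of a diagram with `n` rows (some possibly empty) of lengths `a 0, …, a (n - 1)`.
The box `⟨i, j⟩` is the `j`-th box of row `i` (both counted from `0`). -/
abbrev Cell {n : ℕ} (a : Fin n → ℕ) : Type := (i : Fin n) × Fin (a i)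

/-- Row of a box, counted from `0`. -/
def Cell.row {n : ℕ} {a : Fin n → ℕ} (c : Cell a) : Fin n := c.1

/-- Column of a box of the (left-adjusted) Young diagram, counted from `0`. -/
def Cell.col {n : ℕ} {a : Fin n → ℕ} (c : Cell a) : ℕ := c.2.val

/-- Column of a box of the shifted Young diagram, in which row `i` starts in column `i`. -/
def Cell.shiftedCol {n : ℕ} {a : Fin n → ℕ} (c : Cell a) : ℕ := c.1.val + c.2.val

/-- The staircase `δ = (n, n - 1, …, 1)`. -/
def delta (n : ℕ) : Fin n → ℕ := fun i => n - i.val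

/-- Semistandard symplectic tableaux of shape `lam`. -/
structure IsSymplecticTableau {n : ℕ} {lam : Fin n → ℕ} (T : Cell lam → Letter n) : Prop where
  /-- entries weakly increase along rows -/
  row_weak : ∀ c d : Cell lam, c.row = d.row → c.col < d.col → T c ≤ T d
  /-- entries strictly increase down columns -/
  col_strict : ∀ c d : Cell lam, c.col = d.col → c.row < d.row → T c < T d
  /-- `k` and `k̄` appear no lower than row `k` -/
  no_lower : ∀ c : Cell lam, c.row ≤ (T c).idx

/-- Primed semistandard shifted symplectic tableaux of shifted shape `mu`, with primes allowed on
the main diagonal. -/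
structure IsQST {n : ℕ} {mu : Fin n → ℕ} (S : Cell mu → PrimedLetter n) : Prop where
  /-- entries weakly increase along rows -/
  row_weak : ∀ c d : Cell mu, c.row = d.row → c.shiftedCol < d.shiftedCol → S c ≤ S d
  /-- entries weakly increase down columns -/
  col_weak : ∀ c d : Cell mu, c.shiftedCol = d.shiftedCol → c.row < d.row → S c ≤ S d
  /-- no two identical unprimed entries in a column -/
  col_unprimed : ∀ c d : Cell mu, c.shiftedCol = d.shiftedCol → c ≠ d →
    (S c).primed = false → S c ≠ S d
  /-- no two identical primed entries in a row -/
  row_primed : ∀ c d : Cell mu, c.row = d.row → c ≠ d →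
    (S c).primed = true → S c ≠ S d
  /-- the `k`-th entry of the main diagonal is one of `k̄', k̄, k', k` -/
  diag : ∀ c : Cell mu, c.shiftedCol = c.row.val → (S c).idx = c.row

/-- Primed shifted tableaux of shape `δ` in which every entry `k` or `k̄` lies in row `k`
and every entry `k'` or `k̄'` lies in column `k`. -/
structure IsQD {n : ℕ} (D : Cell (delta n) → PrimedLetter n) : Prop where
  unprimed_row : ∀ c : Cell (delta n), (D c).primed = false → (D c).idx = c.row
  primed_col : ∀ c : Cell (delta n), (D c).primed = true → (D c).idx.val = c.shiftedCol

open Classical in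
/-- The finite set of semistandard symplectic tableaux of shape `lam`. -/
noncomputable def symplecticTableaux {n : ℕ} (lam : Fin n → ℕ) :
    Finset (Cell lam → Letter n) :=
  Finset.univ.filter IsSymplecticTableau

open Classical in
/-- The finite set of primed semistandard shifted symplectic tableaux of shape `mu`. -/
noncomputable def QST {n : ℕ} (mu : Fin n → ℕ) : Finset (Cell mu → PrimedLetter n) :=
  Finset.univ.filter IsQST

open Classical in
/-- The finite set of primed shifted tableaux of shape `δ` described by `IsQD`. -/
noncomputable def QD (n : ℕ) : Finset (Cell (delta n) → PrimedLetter n) :=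
  Finset.univ.filter IsQD

/-- Number of occurrences of the letter `e` in the filling `S`. -/
def occ {C L : Type} [Fintype C] [DecidableEq L] (S : C → L) (e : L) : ℕ :=
  (Finset.univ.filter fun c => S c = e).card

/-- Weight of a symplectic tableau: `w_k = n_k - n_{k̄}`. -/
def wgt {n : ℕ} {lam : Fin n → ℕ} (T : Cell lam → Letter n) (k : Fin n) : ℤ :=
  (occ T ⟨k, false⟩ : ℤ) - (occ T ⟨k, true⟩ : ℤ)

/-- Number of barred entries of a symplectic tableau. -/
def bar {n : ℕ} {lam : Fin n → ℕ} (T : Cell lam → Letter n) : ℕ :=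
  (Finset.univ.filter fun c => (T c).barred = true).card

/-- Unprimed part of the weight of a primed tableau: `u_k = n_k - n_{k̄}`. -/
def wgtU {n : ℕ} {mu : Fin n → ℕ} (S : Cell mu → PrimedLetter n) (k : Fin n) : ℤ :=
  (occ S ⟨k, false, false⟩ : ℤ) - (occ S ⟨k, true, false⟩ : ℤ)

/-- Primed part of the weight of a primed tableau: `v_k = n_{k'} - n_{k̄'}`. -/
def wgtV {n : ℕ} {mu : Fin n → ℕ} (S : Cell mu → PrimedLetter n) (k : Fin n) : ℤ :=
  (occ S ⟨k, false, true⟩ : ℤ) - (occ S ⟨k, true, true⟩ : ℤ)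

/-- Number of barred entries (primed or not) of a primed tableau. -/
def barP {n : ℕ} {mu : Fin n → ℕ} (S : Cell mu → PrimedLetter n) : ℕ :=
  (Finset.univ.filter fun c => (S c).barred = true).card

/-- The monomial `x^w = ∏ x_k ^ w_k`, with integer exponents, in invertible variables `x_k`. -/
def monomial {R : Type*} [CommRing R] {n : ℕ} (x : Fin n → Rˣ) (w : Fin n → ℤ) : R :=
  ((∏ k, x k ^ w k : Rˣ) : R)

/-- The `t`-deformed symplectic character
`sp_λ(x; t) = ∑_T t^(2 bar T) x^(wgt T)`, over semistandard symplectic tableaux of shape `λ`. -/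
noncomputable def sp {R : Type*} [CommRing R] {n : ℕ} (lam : Fin n → ℕ)
    (x : Fin n → Rˣ) (t : R) : R :=
  ∑ T ∈ symplecticTableaux lam, t ^ (2 * bar T) * monomial x (wgt T)

/-- The generalised `Q`-function
`Q_μ(x/y; t) = ∑_S t^(2 bar S) x^u y^v` with `wgt S = (u/v)`, over primed semistandard shifted
symplectic tableaux of shape `μ` with primes allowed on the main diagonal. -/
noncomputable def Q {R : Type*} [CommRing R] {n : ℕ} (mu : Fin n → ℕ)
    (x y : Fin n → Rˣ) (t : R) : R :=
  ∑ S ∈ QST mu, t ^ (2 * barP S) * (monomial x (wgtU S) * monomial y (wgtV S))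

end SymplecticTableaux

/-! Give each box the weight of its letter (`x_k`, `t² / x_k`, `y_k` or `t² / y_k`). Both tableau
sums then become determinants of coefficients of power series in `z`, and the two matrices differ by
a triangular factor whose determinant is the product in the claim.

The determinants come from removing the largest letter repeatedly. An unprimed letter of weight `a`
occupies a horizontal strip, and summing over such strips multiplies every column series by `1 / (1
- a z)` (`rowsDet_geom`). A primed letter occupies a vertical strip and contributes `1 + a z`
(`rowsDet_linear`). When the letters of a new index `k` become available, one unit row of the matrix
turns into an active row; this encodes the condition on row `k` or on the `k`-th diagonal entry
(`sum_spFillings_new_row`, `sum_qstFillings_new_row`).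

Count indices from `0` and put `p = t²`, `s_m = x_m + p / x_m`, `r_m = y_m + p / y_m`, `g_m = 1 / (1
- s_m z + p z²)` and `q_m = g_m (1 + r_m z + p z²)`. The symplectic sum is the determinant with
entries `[z^(λ_i + n - 1 - i)] z^(n - 1 - j) ∏_{m ≥ j} g_m`. The shifted sum is the one with entries
`[z^(μ_i)] (q_j - 1) ∏_{m > j} q_m`.

The quadratic terms involve the same `p`, so `(1 + ρ z + p z²) g_j = 1 + (s_j + ρ) z g_j` for every
`ρ`. In particular `q_j - 1 = (s_j + r_j) z g_j`. Repeated use expands the `j`-th shifted column in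
the symplectic columns `l ≥ j`, up to a factor `z` that accounts for `μ_i = (λ_i + n - 1 - i) + 1`.
The diagonal coefficient is `∏_{m ≥ j} (s_j + r_m)`, so the transition determinant is `∏_{i ≤ j}
(s_i + r_j)` (`rowsDet_qSeries`). Finally, each box of a `QD` filling is filled independently, which
gives the same product (`sum_QD`). -/

namespace SymplecticTableaux

/-! ### Determinants with varying rows and sums over strips -/

section Determinants

variable {R : Type*} [CommRing R] {n : ℕ}

/-- The matrix whose `i`-th row is `v (p i)` for `i < m`, and the unit vector `e_i` for `i ≥ m`. -/
def rowsMatrix (m : ℕ) (v : ℕ → Fin n → R) (p : Fin n → ℕ) : Matrix (Fin n) (Fin n) R :=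
  fun i => if i.val < m then v (p i) else Pi.single i 1

/-- The determinant of `rowsMatrix`. -/
def rowsDet (m : ℕ) (v : ℕ → Fin n → R) (p : Fin n → ℕ) : R :=
  (rowsMatrix m v p).det

/-- The first `m` values of `p` strictly decrease. -/
def StrictDecr (m : ℕ) (p : Fin n → ℕ) : Prop :=
  ∀ i j : Fin n, i < j → j.val < m → p j < p i

instance (m : ℕ) (p : Fin n → ℕ) : Decidable (StrictDecr m p) := by
  unfold StrictDecr; infer_instance

/-- The strict sequences `q` with `p (i + 1) < q i ≤ p i` for `i < m`. -/
def horizontalStrips (m : ℕ) (p : Fin n → ℕ) : Finset (Fin n → ℕ) :=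
  Fintype.piFinset fun i => if i.val < m then
    (Finset.range (p i + 1)).filter fun l => ∀ j : Fin n, i < j → j.val < m → p j < l
  else {p i}

/-- The strict sequences `q` with `p i - 1 ≤ q i ≤ p i` for `i < m`. -/
def verticalStrips (m : ℕ) (p : Fin n → ℕ) : Finset (Fin n → ℕ) :=
  (Fintype.piFinset fun i => if i.val < m then
    (Finset.range (p i + 1)).filter fun l => p i ≤ l + 1
  else {p i}).filter (StrictDecr m)

theorem mem_horizontalStrips {m : ℕ} {p q : Fin n → ℕ} :
    q ∈ horizontalStrips m p ↔ (∀ i, q i ≤ p i) ∧ (∀ i, m ≤ i.val → q i = p i) ∧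
      ∀ i j : Fin n, i < j → j.val < m → p j < q i := by
  simp only [horizontalStrips, Fintype.mem_piFinset]
  constructor
  · intro h
    refine ⟨fun i => ?_, fun i hi => ?_, fun i j hij hj => ?_⟩
    · have := h i
      split_ifs at this
      · simp only [Finset.mem_filter, Finset.mem_range] at this; omega
      · simp only [Finset.mem_singleton] at this; omega
    · have := h i
      rw [if_neg (by omega)] at this
      simpa using this
    · have := h i
      rw [if_pos (by have : i.val < j.val := hij; omega)] at this
      exact (Finset.mem_filter.1 this).2 j hij hj
  · rintro ⟨h1, h2, h3⟩ i
    split_ifs with hi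
    · simp only [Finset.mem_filter, Finset.mem_range]
      exact ⟨by have := h1 i; omega, fun j => h3 i j⟩
    · simpa using h2 i (by omega)

theorem mem_verticalStrips {m : ℕ} {p q : Fin n → ℕ} :
    q ∈ verticalStrips m p ↔ (∀ i, q i ≤ p i) ∧ (∀ i, m ≤ i.val → q i = p i) ∧
      (∀ i, p i ≤ q i + 1) ∧ StrictDecr m q := by
  simp only [verticalStrips, Finset.mem_filter, Fintype.mem_piFinset]
  constructor
  · rintro ⟨h, hs⟩
    refine ⟨fun i => ?_, fun i hi => ?_, fun i => ?_, hs⟩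
    · have := h i
      split_ifs at this
      · simp only [Finset.mem_filter, Finset.mem_range] at this; omega
      · simp only [Finset.mem_singleton] at this; omega
    · have := h i
      rw [if_neg (by omega)] at this
      simpa using this
    · have := h i
      split_ifs at this
      · simp only [Finset.mem_filter, Finset.mem_range] at this; omega
      · simp only [Finset.mem_singleton] at this; omega
  · rintro ⟨h1, h2, h3, h4⟩
    refine ⟨fun i => ?_, h4⟩
    split_ifs with hi
    · simp only [Finset.mem_filter, Finset.mem_range]
      exact ⟨by have := h1 i; omega, h3 i⟩
    · simpa using h2 i (by omega)

/-- Multilinear expansion of a determinant whose active rows are weighted sums of `v l`. -/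
theorem det_rows_sum (m : ℕ) (x : R) (v : ℕ → Fin n → R) (p : Fin n → ℕ)
    (A : Fin n → Finset ℕ) :
    Matrix.det (fun i => if i.val < m then ∑ l ∈ A i, x ^ (p i - l) • v l
        else (Pi.single i 1 : Fin n → R)) =
      ∑ q ∈ Fintype.piFinset fun i => if i.val < m then A i else {p i},
        (∏ i, x ^ (p i - q i)) * rowsDet m v q := by
  have hrow : (fun i : Fin n => if i.val < m then ∑ l ∈ A i, x ^ (p i - l) • v l
        else (Pi.single i 1 : Fin n → R)) =
      fun i => ∑ l ∈ (if i.val < m then A i else {p i}),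
        x ^ (p i - l) • (if i.val < m then v l else (Pi.single i 1 : Fin n → R)) := by
    funext i
    split_ifs with hi
    · rfl
    · simp
  rw [hrow]
  have := (Matrix.detRowAlternating (n := Fin n) (R := R)).toMultilinearMap.map_sum_finset
    (fun i l => x ^ (p i - l) • (if i.val < m then v l else (Pi.single i 1 : Fin n → R)))
    (fun i => if i.val < m then A i else {p i})
  refine Eq.trans this (Finset.sum_congr rfl fun q _ => ?_)
  rw [MultilinearMap.map_smul_univ, smul_eq_mul]
  rfl

/-- The recurrence is unrolled only down to level `b`, so that subtracting a multiple of `v' b`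
leaves exactly the terms with `b < l ≤ b + d`. -/
theorem eq_smul_add_sum_of_recurrence {M : Type*} [AddCommGroup M] [Module R M] {x : R}
    {v v' : ℕ → M} (hs : ∀ l, v' (l + 1) = v (l + 1) + x • v' l) (b d : ℕ) :
    v' (b + d) = x ^ d • v' b + ∑ l ∈ Finset.Ioc b (b + d), x ^ (b + d - l) • v l := by
  induction d with
  | zero => simp
  | succ d ih =>
    rw [← add_assoc, hs, ih, ← Finset.insert_Ioc_right_eq_Ioc_add_one (by omega),
      Finset.sum_insert (by simp), smul_add, smul_smul, pow_succ', Finset.smul_sum]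
    have : ∑ l ∈ Finset.Ioc b (b + d), x ^ (b + d + 1 - l) • v l =
        ∑ l ∈ Finset.Ioc b (b + d), x • x ^ (b + d - l) • v l := by
      refine Finset.sum_congr rfl fun l hl => ?_
      rw [Finset.mem_Ioc] at hl
      rw [smul_smul, ← pow_succ', show b + d + 1 - l = b + d - l + 1 by omega]
    rw [this]
    simp only [Nat.sub_self, pow_zero, one_smul]
    abel

theorem eq_sum_of_recurrence {M : Type*} [AddCommGroup M] [Module R M] {x : R}
    {v v' : ℕ → M} (h0 : v' 0 = v 0) (hs : ∀ l, v' (l + 1) = v (l + 1) + x • v' l) (d : ℕ) :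
    v' d = ∑ l ∈ Finset.range (d + 1), x ^ (d - l) • v l := by
  have h := eq_smul_add_sum_of_recurrence hs 0 d
  rw [zero_add] at h
  rw [h, h0, Finset.range_eq_Ico, Finset.sum_eq_sum_Ico_succ_bot (by omega)]
  rfl

/-- Row `i` is a geometric sum over all `l ≤ p i`. Subtracting a multiple of row `i + 1` truncates
it to `p (i + 1) < l ≤ p i` without changing the determinant. Multilinearity then produces exactly
the horizontal strips, with no cancellation left to perform. -/
theorem rowsDet_geom (m : ℕ) (x : R) (v v' : ℕ → Fin n → R) (h0 : v' 0 = v 0)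
    (hs : ∀ l, v' (l + 1) = v (l + 1) + x • v' l) (p : Fin n → ℕ) (hp : StrictDecr m p) :
    rowsDet m v' p = ∑ q ∈ horizontalStrips m p, (∏ i, x ^ (p i - q i)) * rowsDet m v q := by
  rw [horizontalStrips, ← det_rows_sum]
  -- `1 - N` is unitriangular and performs all these row operations at once.
  set N : Matrix (Fin n) (Fin n) R := fun i j =>
    if j.val = i.val + 1 ∧ j.val < m then x ^ (p i - p j) else 0 with hN
  have hU : (1 - N).det = 1 := by
    rw [Matrix.det_of_isUpperTriangular]
    · refine Finset.prod_eq_one fun i _ => ?_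
      rw [Matrix.sub_apply, Matrix.one_apply_eq]
      simp [hN]
    · intro i j hij
      have hij' : j.val < i.val := hij
      have : j ≠ i := by rintro rfl; omega
      rw [Matrix.sub_apply, Matrix.one_apply_ne this.symm]
      simp only [hN]
      rw [if_neg (by omega), sub_zero]
  have hdet : rowsDet m v' p = ((1 - N) * rowsMatrix m v' p).det := by
    rw [Matrix.det_mul, hU, one_mul, rowsDet]
  rw [hdet]
  congr 1
  funext i
  rw [sub_mul, one_mul]
  have hNM : (N * rowsMatrix m v' p) i = if h : i.val + 1 < n ∧ i.val + 1 < m then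
      x ^ (p i - p ⟨i.val + 1, h.1⟩) • v' (p ⟨i.val + 1, h.1⟩) else 0 := by
    funext c
    rw [Matrix.mul_apply]
    split_ifs with h
    · rw [Finset.sum_eq_single (⟨i.val + 1, h.1⟩ : Fin n)]
      · simp [hN, rowsMatrix, h.2]
      · intro j _ hj
        simp only [hN]
        rw [if_neg, zero_mul]
        rintro ⟨h1, -⟩
        exact hj (Fin.ext h1)
      · simp
    · refine Finset.sum_eq_zero fun j _ => ?_
      simp only [hN]
      rw [if_neg, zero_mul]
      have := j.isLt
      omega
  have hsub : (rowsMatrix m v' p - N * rowsMatrix m v' p) i =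
      rowsMatrix m v' p i - (N * rowsMatrix m v' p) i := rfl
  rw [hsub, hNM, rowsMatrix]
  by_cases hi : i.val < m
  · rw [if_pos hi, if_pos hi]
    split_ifs with h
    · set k : Fin n := ⟨i.val + 1, h.1⟩ with hk
      have hlt : p k < p i := hp i k (by rw [Fin.lt_def]; simp [hk]) h.2
      have h1 := eq_smul_add_sum_of_recurrence hs (p k) (p i - p k)
      rw [Nat.add_sub_cancel' hlt.le] at h1
      rw [h1, add_sub_cancel_left]
      refine Finset.sum_congr ?_ fun _ _ => rfl
      ext l
      simp only [Finset.mem_Ioc, Finset.mem_filter, Finset.mem_range]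
      constructor
      · rintro ⟨h2, h3⟩
        refine ⟨by omega, fun j hij hj => ?_⟩
        have hij' : i.val < j.val := hij
        rcases (show j = k ∨ k < j by
          rw [Fin.lt_def, Fin.ext_iff]; simp only [hk]; omega) with rfl | hkj
        · exact h2
        · exact (hp k j hkj hj).trans h2
      · rintro ⟨h2, h3⟩
        exact ⟨h3 k (by rw [Fin.lt_def]; simp [hk]) h.2, by omega⟩
    -- The last active row has no active row below it: its sum stays complete, and the strip
    -- condition on it is vacuous.
    · rw [sub_zero, eq_sum_of_recurrence h0 hs]
      refine Finset.sum_congr ?_ fun _ _ => rfl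
      rw [Finset.filter_true_of_mem]
      intro l _ j hij hj
      have hij' : i.val < j.val := hij
      have := j.isLt
      omega
  · rw [if_neg hi, if_neg hi, dif_neg (by omega), sub_zero]

/-- Each row has at most two terms, `l = p i` and `l = p i - 1`. In the multilinear expansion the
choices that are not strictly decreasing repeat a row and vanish; the others are the vertical
strips. -/
theorem rowsDet_linear (m : ℕ) (y : R) (v v' : ℕ → Fin n → R) (h0 : v' 0 = v 0)
    (hs : ∀ l, v' (l + 1) = v (l + 1) + y • v l) (p : Fin n → ℕ) (hp : StrictDecr m p) :
    rowsDet m v' p = ∑ q ∈ verticalStrips m p, (∏ i, y ^ (p i - q i)) * rowsDet m v q := by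
  have hv : ∀ a, v' a =
      ∑ l ∈ (Finset.range (a + 1)).filter (fun l => a ≤ l + 1), y ^ (a - l) • v l := by
    intro a
    cases a with
    | zero => simp [h0, Finset.filter_true_of_mem]
    | succ a =>
      have : (Finset.range (a + 1 + 1)).filter (fun l => a + 1 ≤ l + 1) = {a + 1, a} := by
        ext l; simp; omega
      rw [this, Finset.sum_pair (by omega), hs]
      simp
  rw [verticalStrips, Finset.sum_filter_of_ne, ← det_rows_sum]
  · rw [rowsDet]
    congr 1
    funext i
    rw [rowsMatrix]
    split_ifs with hi
    · exact hv _
    · rfl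
  · intro q hq hne i j hij hj
    by_contra hcon
    apply hne
    have hij' : i.val < j.val := hij
    have hqi := Fintype.mem_piFinset.1 hq i
    have hqj := Fintype.mem_piFinset.1 hq j
    rw [if_pos (by omega)] at hqi hqj
    simp only [Finset.mem_filter, Finset.mem_range] at hqi hqj
    have := hp i j hij hj
    -- If strictness fails, then `q j ≤ p j ≤ p i - 1 ≤ q i ≤ q j`, so all are equal.
    have heq : q i = q j := by omega
    rw [rowsDet, Matrix.det_zero_of_row_eq hij.ne, mul_zero]
    simp [rowsMatrix, heq, hj, hij'.trans hj]

end Determinants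

/-! ### Removing the largest letter from a filling -/

section Peel

variable {n : ℕ} {L : Type}

/-- The number of entries of rank `< r` in each row. -/
def subShape {mu : Fin n → ℕ} (rank : L → ℕ) (r : ℕ) (T : Cell mu → L) : Fin n → ℕ :=
  fun i => (Finset.univ.filter fun j : Fin (mu i) => rank (T ⟨i, j⟩) < r).card

/-- Restriction of a filling to a smaller diagram. -/
def restrictFilling {mu nu : Fin n → ℕ} (h : ∀ i, nu i ≤ mu i) (T : Cell mu → L) : Cell nu → L :=
  fun c => T ⟨c.1, Fin.castLE (h c.1) c.2⟩

/-- Extension of a filling to a larger diagram by the letter `a`. -/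
def extendFilling {mu nu : Fin n → ℕ} (a : L) (T : Cell nu → L) : Cell mu → L :=
  fun c => if h : c.2.val < nu c.1 then T ⟨c.1, ⟨c.2, h⟩⟩ else a

theorem extendFilling_of_lt {mu nu : Fin n → ℕ} {a : L} {T : Cell nu → L} {c : Cell mu}
    (h : c.2.val < nu c.1) : extendFilling a T c = T ⟨c.1, ⟨c.2, h⟩⟩ :=
  dif_pos h

theorem extendFilling_of_le {mu nu : Fin n → ℕ} {a : L} {T : Cell nu → L} {c : Cell mu}
    (h : nu c.1 ≤ c.2.val) : extendFilling a T c = a :=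
  dif_neg (by omega)

theorem subShape_le {mu : Fin n → ℕ} (rank : L → ℕ) (r : ℕ) (T : Cell mu → L) (i : Fin n) :
    subShape rank r T i ≤ mu i :=
  (Finset.card_filter_le _ _).trans (by simp)

/-- By monotonicity the positions with small value form an initial segment, so their number decides
membership. -/
theorem lt_card_filter_iff {b : ℕ} {f : Fin b → ℕ} (hf : Monotone f) (r : ℕ) (j : Fin b) :
    j.val < (Finset.univ.filter fun j => f j < r).card ↔ f j < r := by
  constructor
  · intro h
    by_contra hcon
    have : (Finset.univ.filter fun j => f j < r) ⊆ Finset.Iio j := by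
      intro i hi
      rw [Finset.mem_filter] at hi
      rw [Finset.mem_Iio]
      by_contra hij
      have := hf (not_lt.1 hij)
      omega
    have := Finset.card_le_card this
    rw [Fin.card_Iio] at this
    omega
  · intro h
    have : Finset.Iic j ⊆ (Finset.univ.filter fun j => f j < r) := by
      intro i hi
      rw [Finset.mem_Iic] at hi
      have := hf hi
      simp only [Finset.mem_filter, Finset.mem_univ, true_and]
      omega
    have := Finset.card_le_card this
    rw [Fin.card_Iic] at this
    omega

theorem lt_subShape_iff {mu : Fin n → ℕ} {rank : L → ℕ} {T : Cell mu → L}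
    (hT : ∀ c d : Cell mu, c.1 = d.1 → c.2.val < d.2.val → rank (T c) ≤ rank (T d))
    (r : ℕ) (i : Fin n) (j : Fin (mu i)) :
    j.val < subShape rank r T i ↔ rank (T ⟨i, j⟩) < r := by
  refine lt_card_filter_iff (f := fun j => rank (T ⟨i, j⟩)) (fun j k hjk => ?_) r j
  rcases hjk.eq_or_lt with rfl | h
  · exact le_rfl
  · exact hT ⟨i, j⟩ ⟨i, k⟩ rfl h

theorem eq_extendFilling {mu : Fin n → ℕ} {rank : L → ℕ} (hinj : Function.Injective rank)
    {T : Cell mu → L}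
    (hT : ∀ c d : Cell mu, c.1 = d.1 → c.2.val < d.2.val → rank (T c) ≤ rank (T d))
    (a : L) (ha : ∀ c, rank (T c) < rank a + 1) :
    T = extendFilling a (restrictFilling (subShape_le rank (rank a) T) T) := by
  funext c
  by_cases h : c.2.val < subShape rank (rank a) T c.1
  · rw [extendFilling_of_lt h]
    rfl
  · rw [extendFilling_of_le (not_lt.1 h)]
    rw [lt_subShape_iff hT] at h
    have := ha c
    exact hinj (by change ¬ rank (T c) < rank a at h; omega)

theorem prod_dite_lt {R : Type*} [CommMonoid R] {a b : ℕ} (hab : a ≤ b) (f : Fin a → R) (z : R) :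
    ∏ j : Fin b, (if h : j.val < a then f ⟨j, h⟩ else z) = z ^ (b - a) * ∏ j, f j := by
  obtain ⟨d, rfl⟩ := Nat.exists_eq_add_of_le hab
  rw [Fin.prod_univ_add, mul_comm]
  simp

theorem prod_extendFilling {R : Type*} [CommMonoid R] {mu nu : Fin n → ℕ} (h : ∀ i, nu i ≤ mu i)
    (w : L → R) (a : L) (T : Cell nu → L) :
    ∏ c : Cell mu, w (extendFilling a T c) = (∏ i, w a ^ (mu i - nu i)) * ∏ c, w (T c) := by
  rw [Fintype.prod_sigma, Fintype.prod_sigma, ← Finset.prod_mul_distrib]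
  refine Finset.prod_congr rfl fun i _ => ?_
  rw [← prod_dite_lt (h i) (fun j => w (T ⟨i, j⟩))]
  refine Finset.prod_congr rfl fun j _ => ?_
  simp only [extendFilling]
  split_ifs <;> rfl

/-- The inner shape can be read off from an extended filling, because the letter `a` does not occur
inside it. This gives injectivity of the extension map across different shapes. -/
theorem le_of_extendFilling_eq {mu nu nu' : Fin n → ℕ} (h : ∀ i, nu i ≤ mu i)
    {a : L} {T : Cell nu → L} {T' : Cell nu' → L} (hT : ∀ c, T c ≠ a)
    (heq : extendFilling (mu := mu) a T = extendFilling a T') (i : Fin n) : nu i ≤ nu' i := by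
  by_contra hcon
  have h1 := congrFun heq ⟨i, ⟨nu' i, by have := h i; omega⟩⟩
  rw [extendFilling_of_lt (show nu' i < nu i by omega), extendFilling_of_le le_rfl] at h1
  exact hT _ h1

/-- Removal of the largest letter `a`: a sum over fillings of shape `mu` as a sum over the
shapes `nu` occupied by the letters other than `a`. -/
theorem sum_fillings_eq_sum_subshapes {R : Type*} [CommRing R] {mu : Fin n → ℕ}
    (w : L → R) (a : L)
    (F : Finset (Cell mu → L)) (G : ∀ nu : Fin n → ℕ, Finset (Cell nu → L))
    (A : Finset (Fin n → ℕ)) (hA : ∀ nu ∈ A, ∀ i, nu i ≤ mu i)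
    (hF : ∀ T ∈ F, ∃ nu ∈ A, ∃ T' ∈ G nu, T = extendFilling a T')
    (hG : ∀ nu ∈ A, ∀ T' ∈ G nu, extendFilling a T' ∈ F)
    (hne : ∀ nu ∈ A, ∀ T' ∈ G nu, ∀ c, T' c ≠ a) :
    ∑ T ∈ F, ∏ c, w (T c) =
      ∑ nu ∈ A, (∏ i, w a ^ (mu i - nu i)) * ∑ T ∈ G nu, ∏ c, w (T c) := by
  simp_rw [Finset.mul_sum]
  rw [Finset.sum_sigma']
  symm
  refine Finset.sum_bij (fun s _ => extendFilling a s.2) ?_ ?_ ?_ ?_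
  · rintro ⟨nu, T⟩ h
    rw [Finset.mem_sigma] at h
    exact hG nu h.1 T h.2
  · rintro ⟨nu, T⟩ h ⟨nu', T'⟩ h' heq
    rw [Finset.mem_sigma] at h h'
    have e : nu = nu' := funext fun i => le_antisymm
      (le_of_extendFilling_eq (hA nu h.1) (hne nu h.1 T h.2) heq i)
      (le_of_extendFilling_eq (hA nu' h'.1) (hne nu' h'.1 T' h'.2) heq.symm i)
    subst e
    congr 1
    funext c
    have := congrFun heq ⟨c.1, Fin.castLE (hA nu h.1 c.1) c.2⟩
    simp only at this
    rw [extendFilling_of_lt (by simp), extendFilling_of_lt (by simp)] at this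
    exact this
  · intro T hT
    obtain ⟨nu, hnu, T', hT', rfl⟩ := hF T hT
    exact ⟨⟨nu, T'⟩, Finset.mem_sigma.2 ⟨hnu, hT'⟩, rfl⟩
  · rintro ⟨nu, T⟩ h
    rw [Finset.mem_sigma] at h
    exact (prod_extendFilling (hA nu h.1) w a T).symm

end Peel

/-! ### Power series and the recurrences of their coefficients -/

section Series

open PowerSeries

variable {R : Type*} [CommRing R] {n : ℕ}

/-- The geometric series `1 / (1 - a z)`. -/
def geom (a : R) : R⟦X⟧ := PowerSeries.mk fun k => a ^ k

theorem geom_eq (a : R) : geom a = 1 + C a * (X * geom a) := by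
  ext l
  cases l with
  | zero => simp [geom]
  | succ l => simp [geom, coeff_succ_X_mul, coeff_one, pow_succ']

theorem geom_mul_one_sub (a : R) : geom a * (1 - C a * X) = 1 := by
  linear_combination geom_eq a

/-- The row vectors of coefficients of a family of power series. -/
noncomputable def coeffRows (f : Fin n → R⟦X⟧) : ℕ → Fin n → R := fun l j => coeff l (f j)

/-- With `coeffRows_geom_succ`, this supplies the recurrence required by `rowsDet_geom`: multiplying
all columns by `1 / (1 - a z)` is summation over horizontal strips. -/
theorem coeffRows_geom_zero (a : R) (f : Fin n → R⟦X⟧) :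
    coeffRows (fun j => geom a * f j) 0 = coeffRows f 0 := by
  funext j
  simp [coeffRows, geom]

theorem coeffRows_geom_succ (a : R) (f : Fin n → R⟦X⟧) (l : ℕ) :
    coeffRows (fun j => geom a * f j) (l + 1) =
      coeffRows f (l + 1) + a • coeffRows (fun j => geom a * f j) l := by
  funext j
  have h : geom a * f j = f j + C a * (X * (geom a * f j)) := by
    linear_combination f j * geom_eq a
  simp only [coeffRows, Pi.add_apply, Pi.smul_apply, smul_eq_mul]
  conv_lhs => rw [h]
  rw [map_add, coeff_C_mul, coeff_succ_X_mul]

/-- With `coeffRows_linear_succ`, this supplies the recurrence required by `rowsDet_linear`, for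
vertical strips. -/
theorem coeffRows_linear_zero (a : R) (f : Fin n → R⟦X⟧) :
    coeffRows (fun j => (1 + C a * X) * f j) 0 = coeffRows f 0 := by
  funext j
  simp [coeffRows]

theorem coeffRows_linear_succ (a : R) (f : Fin n → R⟦X⟧) (l : ℕ) :
    coeffRows (fun j => (1 + C a * X) * f j) (l + 1) =
      coeffRows f (l + 1) + a • coeffRows f l := by
  funext j
  have h : (1 + C a * X) * f j = f j + C a * (X * f j) := by ring
  simp only [coeffRows, Pi.add_apply, Pi.smul_apply, smul_eq_mul]
  rw [h, map_add, coeff_C_mul, coeff_succ_X_mul]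

end Series

/-! ### The determinant for symplectic tableaux -/

section Symplectic

open PowerSeries

variable {R : Type*} [CommRing R] {n : ℕ}

open Classical in
/-- The symplectic tableaux of shape `lam` whose entries have rank `< r`. -/
noncomputable def spFillings (r : ℕ) (lam : Fin n → ℕ) : Finset (Cell lam → Letter n) :=
  Finset.univ.filter fun T => IsSymplecticTableau T ∧ ∀ c, (T c).rank < r

theorem mem_spFillings {r : ℕ} {lam : Fin n → ℕ} {T : Cell lam → Letter n} :
    T ∈ spFillings r lam ↔ IsSymplecticTableau T ∧ ∀ c, (T c).rank < r := by
  simp [spFillings]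

/-- Partitions with at most `m` nonzero parts. -/
def IsShape (m : ℕ) (lam : Fin n → ℕ) : Prop :=
  Antitone lam ∧ ∀ i, m ≤ i.val → lam i = 0

/-- Positions of the particles attached to the first `m` parts of a partition. -/
def particles (m : ℕ) (lam : Fin n → ℕ) : Fin n → ℕ := fun i => lam i + (m - 1 - i.val)

/-- The shapes `nu` such that `lam / nu` is a horizontal strip. -/
def interlacing (lam : Fin n → ℕ) : Finset (Fin n → ℕ) :=
  (Fintype.piFinset fun i => Finset.range (lam i + 1)).filter
    fun nu => ∀ i j : Fin n, i < j → lam j ≤ nu i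

theorem mem_interlacing {lam nu : Fin n → ℕ} :
    nu ∈ interlacing lam ↔ (∀ i, nu i ≤ lam i) ∧ ∀ i j : Fin n, i < j → lam j ≤ nu i := by
  simp [interlacing]

theorem IsShape.of_mem_interlacing {m : ℕ} {lam nu : Fin n → ℕ} (h : IsShape m lam)
    (hnu : nu ∈ interlacing lam) : IsShape m nu := by
  rw [mem_interlacing] at hnu
  refine ⟨fun i j hij => ?_, fun i hi => ?_⟩
  · rcases hij.eq_or_lt with rfl | hlt
    · exact le_rfl
    · exact (hnu.1 j).trans (hnu.2 i j hlt)
  · have := hnu.1 i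
    have := h.2 i hi
    omega

theorem strictDecr_particles {m : ℕ} {lam : Fin n → ℕ} (h : Antitone lam) :
    StrictDecr m (particles m lam) := by
  intro i j hij hj
  have := h hij.le
  have hij' : i.val < j.val := hij
  simp only [particles]
  omega

/-- Adding the staircase turns the weak inequalities `lam (i + 1) ≤ nu i` into the strict ones of
`horizontalStrips`. -/
theorem sum_horizontalStrips_particles {M : Type*} [AddCommMonoid M] {m : ℕ} (hm : m ≤ n)
    {lam : Fin n → ℕ} (h : IsShape m lam) (F : (Fin n → ℕ) → M) :
    ∑ q ∈ horizontalStrips m (particles m lam), F q =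
      ∑ nu ∈ interlacing lam, F (particles m nu) := by
  symm
  refine Finset.sum_nbij (particles m) ?_ ?_ ?_ fun _ _ => rfl
  · intro nu hnu
    rw [mem_interlacing] at hnu
    rw [mem_horizontalStrips]
    refine ⟨fun i => ?_, fun i hi => ?_, fun i j hij hj => ?_⟩
    · have := hnu.1 i
      simp only [particles]; omega
    · have := hnu.1 i
      have := h.2 i hi
      simp only [particles]; omega
    · have := hnu.2 i j hij
      have hij' : i.val < j.val := hij
      simp only [particles]; omega
  · intro nu _ nu' _ heq
    funext i
    have := congrFun heq i
    simp only [particles] at this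
    omega
  · intro q hq
    rw [Finset.mem_coe, mem_horizontalStrips] at hq
    obtain ⟨h1, h2, h3⟩ := hq
    -- This bound ensures that subtracting the staircase from `q` is not truncated at `0`.
    have key : ∀ i : Fin n, ∀ hi : i.val + 1 < m,
        lam ⟨i.val + 1, by omega⟩ + (m - 1 - i.val) ≤ q i := by
      intro i hi
      have := h3 i ⟨i.val + 1, by omega⟩ (by simp [Fin.lt_def]) hi
      simp only [particles] at this
      omega
    refine ⟨fun i => q i - (m - 1 - i.val), ?_, ?_⟩
    · rw [Finset.mem_coe, mem_interlacing]
      refine ⟨fun i => ?_, fun i j hij => ?_⟩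
      · have := h1 i
        simp only [particles] at this
        omega
      · have hij' : i.val < j.val := hij
        by_cases hj : j.val < m
        · have h4 := key i (by omega)
          have h5 : lam j ≤ lam ⟨i.val + 1, by omega⟩ := h.1 (by simp [Fin.le_def]; omega)
          change lam j ≤ q i - (m - 1 - i.val)
          omega
        · rw [h.2 j (by omega)]
          exact Nat.zero_le _
    · funext i
      simp only [particles]
      by_cases hi : i.val + 1 < m
      · have := key i hi
        omega
      · omega

theorem IsSymplecticTableau.rank_le {lam : Fin n → ℕ} {T : Cell lam → Letter n}
    (hT : IsSymplecticTableau T) (c d : Cell lam) (h : c.1 = d.1) (h' : c.2.val < d.2.val) :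
    (T c).rank ≤ (T d).rank :=
  hT.row_weak c d h h'

theorem IsSymplecticTableau.restrict {lam nu : Fin n → ℕ} {T : Cell lam → Letter n}
    (hT : IsSymplecticTableau T) (h : ∀ i, nu i ≤ lam i) :
    IsSymplecticTableau (restrictFilling h T) where
  row_weak _ _ h1 h2 := hT.row_weak _ _ h1 h2
  col_strict _ _ h1 h2 := hT.col_strict _ _ h1 h2
  no_lower c := hT.no_lower ⟨c.1, Fin.castLE (h c.1) c.2⟩

theorem IsSymplecticTableau.extend {lam nu : Fin n → ℕ} {T : Cell nu → Letter n}
    (hT : IsSymplecticTableau T) (hnu : nu ∈ interlacing lam)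
    {a : Letter n} (ha : ∀ c, T c < a) (h0 : ∀ i, 0 < lam i → i ≤ a.idx) :
    IsSymplecticTableau (extendFilling (mu := lam) a T) where
  row_weak := by
    rintro ⟨i, j⟩ ⟨i', j'⟩ (rfl : i = i') (h2 : j.val < j'.val)
    by_cases hd : j'.val < nu i
    · rw [extendFilling_of_lt (c := ⟨i, j'⟩) hd,
        extendFilling_of_lt (c := ⟨i, j⟩) (h2.trans hd)]
      exact hT.row_weak _ _ rfl h2
    · rw [extendFilling_of_le (c := ⟨i, j'⟩) (not_lt.1 hd)]
      by_cases hc : j.val < nu i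
      · rw [extendFilling_of_lt hc]
        exact (ha _).le
      · rw [extendFilling_of_le (not_lt.1 hc)]
  col_strict := by
    rintro ⟨i, j⟩ ⟨i', j'⟩ (h1 : j.val = j'.val) (h2 : i < i')
    -- Since `lam i' ≤ nu i`, the upper of two boxes in a column always belongs to `nu`; hence `a`
    -- is added at most once per column.
    have hc : j.val < nu i := by
      have := (mem_interlacing.1 hnu).2 i i' h2
      have := j'.isLt
      omega
    rw [extendFilling_of_lt hc]
    by_cases hd : j'.val < nu i'
    · rw [extendFilling_of_lt hd]
      exact hT.col_strict _ _ h1 h2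
    · rw [extendFilling_of_le (not_lt.1 hd)]
      exact ha _
  no_lower := by
    rintro ⟨i, j⟩
    by_cases hc : j.val < nu i
    · rw [extendFilling_of_lt hc]
      exact hT.no_lower ⟨i, ⟨j, hc⟩⟩
    · rw [extendFilling_of_le (not_lt.1 hc)]
      exact h0 i (by have := j.isLt; omega)

theorem sum_spFillings_succ (w : Letter n → R) (a : Letter n) {lam : Fin n → ℕ}
    (h : IsShape (a.idx.val + 1) lam) :
    ∑ T ∈ spFillings (a.rank + 1) lam, ∏ c, w (T c) =
      ∑ nu ∈ interlacing lam, (∏ i, w a ^ (lam i - nu i)) *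
        ∑ T ∈ spFillings a.rank nu, ∏ c, w (T c) := by
  refine sum_fillings_eq_sum_subshapes w a _ _ _ (fun nu hnu => (mem_interlacing.1 hnu).1)
    ?_ ?_ ?_
  · intro T hT
    rw [mem_spFillings] at hT
    obtain ⟨hT, hr⟩ := hT
    have hlt := lt_subShape_iff hT.rank_le a.rank
    refine ⟨_, ?_, _, ?_, eq_extendFilling Letter.rank_injective hT.rank_le a hr⟩
    · rw [mem_interlacing]
      refine ⟨subShape_le _ _ _, fun i j hij => ?_⟩
      -- Otherwise consider column `lam j - 1` in rows `i` and `j`. The lower entry is at most `a`,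
      -- so strictness puts the upper one below `a`, and its box lies in the subshape after all.
      by_contra hcon
      push Not at hcon
      have hle := h.1 hij.le
      have hc := hT.col_strict ⟨i, ⟨lam j - 1, by omega⟩⟩ ⟨j, ⟨lam j - 1, by omega⟩⟩ rfl hij
      have hc' : (T ⟨i, ⟨lam j - 1, by omega⟩⟩).rank < (T ⟨j, ⟨lam j - 1, by omega⟩⟩).rank := hc
      have h1 := hr ⟨j, ⟨lam j - 1, by omega⟩⟩
      have h2 := (hlt i ⟨lam j - 1, by omega⟩).2 (by omega)
      simp only at h2
      omega
    · rw [mem_spFillings]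
      refine ⟨hT.restrict _, fun c => ?_⟩
      exact (hlt c.1 _).1 c.2.isLt
  · intro nu hnu T hT
    rw [mem_spFillings] at hT ⊢
    refine ⟨hT.1.extend hnu hT.2 fun i hi => ?_, fun c => ?_⟩
    · by_contra hcon
      have := h.2 i (by rw [Fin.le_def] at hcon; omega)
      omega
    · by_cases hc : c.2.val < nu c.1
      · rw [extendFilling_of_lt hc]
        exact (hT.2 _).trans (Nat.lt_succ_self _)
      · rw [extendFilling_of_le (not_lt.1 hc)]
        exact Nat.lt_succ_self _
  · intro nu _ T hT c hc
    have := (mem_spFillings.1 hT).2 c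
    rw [hc] at this
    exact lt_irrefl _ this

theorem sum_spFillings_geom (w : Letter n → R) (a : Letter n) (f : Fin n → R⟦X⟧)
    (IH : ∀ lam : Fin n → ℕ, IsShape (a.idx.val + 1) lam →
      ∑ T ∈ spFillings a.rank lam, ∏ c, w (T c) =
        rowsDet (a.idx.val + 1) (coeffRows f) (particles (a.idx.val + 1) lam))
    (lam : Fin n → ℕ) (h : IsShape (a.idx.val + 1) lam) :
    ∑ T ∈ spFillings (a.rank + 1) lam, ∏ c, w (T c) =
      rowsDet (a.idx.val + 1) (coeffRows fun j => geom (w a) * f j)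
        (particles (a.idx.val + 1) lam) := by
  rw [sum_spFillings_succ w a h, rowsDet_geom _ _ _ _ (coeffRows_geom_zero (w a) f)
    (coeffRows_geom_succ (w a) f) _ (strictDecr_particles h.1),
    sum_horizontalStrips_particles a.idx.isLt h]
  refine Finset.sum_congr rfl fun nu hnu => ?_
  rw [IH nu (h.of_mem_interlacing hnu)]
  congr 1
  refine Finset.prod_congr rfl fun i _ => ?_
  simp only [particles]
  rw [Nat.add_sub_add_right]

/-- Row `k` is activated before any letter of index `k` is used. If `lam k = 0`, the particle
positions above move up by one, which the factor `X` compensates, and row `k` reads constant terms,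
giving the same unit row as before. If `lam k > 0`, no tableau exists, since row `k` needs letters
of index at least `k`; and column `k` vanishes, since its series `1` is read only in positive
degrees. -/
theorem sum_spFillings_new_row (w : Letter n → R) (k : Fin n) (f f' : Fin n → R⟦X⟧)
    (hf : ∀ j : Fin n, k ≤ j → f j = 0)
    (hf1 : ∀ j : Fin n, j < k → f' j = X * f j) (hf2 : f' k = 1)
    (hf3 : ∀ j : Fin n, k < j → f' j = 0)
    (IH : ∀ lam : Fin n → ℕ, IsShape k.val lam →
      ∑ T ∈ spFillings (2 * k.val) lam, ∏ c, w (T c) =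
        rowsDet k.val (coeffRows f) (particles k.val lam))
    (lam : Fin n → ℕ) (h : IsShape (k.val + 1) lam) :
    ∑ T ∈ spFillings (2 * k.val) lam, ∏ c, w (T c) =
      rowsDet (k.val + 1) (coeffRows f') (particles (k.val + 1) lam) := by
  by_cases hk : lam k = 0
  · rw [IH lam ⟨h.1, fun i hi => Nat.le_zero.1 ((h.1 hi).trans hk.le)⟩]
    unfold rowsDet
    congr 1
    funext i j
    simp only [rowsMatrix]
    rcases lt_trichotomy i k with hik | rfl | hik
    · have hik' : i.val < k.val := hik
      rw [if_pos hik', if_pos (by omega)]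
      have hp : particles (k.val + 1) lam i = particles k.val lam i + 1 := by
        simp only [particles]; omega
      simp only [coeffRows, hp]
      rcases lt_trichotomy j k with hjk | rfl | hjk
      · rw [hf1 j hjk, coeff_succ_X_mul]
      · rw [hf2, hf j le_rfl, coeff_one, if_neg (by omega), map_zero]
      · rw [hf3 j hjk, hf j hjk.le, map_zero, map_zero]
    · rw [if_neg (by omega), if_pos (by omega)]
      have hp : particles (i.val + 1) lam i = 0 := by
        simp only [particles]; omega
      simp only [coeffRows, hp]
      rcases lt_trichotomy j i with hjk | rfl | hjk
      · rw [hf1 j hjk, Pi.single_eq_of_ne hjk.ne]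
        simp
      · rw [hf2, Pi.single_eq_same]
        simp
      · rw [hf3 j hjk, Pi.single_eq_of_ne hjk.ne', map_zero]
    · have hik' : k.val < i.val := hik
      rw [if_neg (by omega), if_neg (by omega)]
  · have hempty : spFillings (2 * k.val) lam = ∅ := by
      rw [Finset.eq_empty_iff_forall_notMem]
      intro T hT
      rw [mem_spFillings] at hT
      have h1 := hT.1.no_lower ⟨k, ⟨0, by omega⟩⟩
      have h2 := hT.2 ⟨k, ⟨0, by omega⟩⟩
      rw [Fin.le_def] at h1
      simp only [Cell.row, Letter.rank] at h1 h2
      omega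
    rw [hempty, Finset.sum_empty, rowsDet]
    symm
    refine Matrix.det_eq_zero_of_column_eq_zero k fun i => ?_
    simp only [rowsMatrix]
    split_ifs with hik
    · have := h.1 (show i ≤ k by rw [Fin.le_def]; omega)
      simp only [coeffRows, hf2, coeff_one, particles]
      rw [if_neg (by omega)]
    · exact Pi.single_eq_of_ne (by rintro rfl; omega) _

/-- The factor contributed by the letters `k` and `k̄`. -/
noncomputable def spFactor (w : Letter n → R) (k : ℕ) : R⟦X⟧ :=
  if h : k < n then geom (w ⟨⟨k, h⟩, false⟩) * geom (w ⟨⟨k, h⟩, true⟩) else 1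

/-- Columns of the determinant for symplectic tableaux with letters of index `< k`. -/
noncomputable def spSeries (w : Letter n → R) (k : ℕ) (j : Fin n) : R⟦X⟧ :=
  if j.val < k then X ^ (k - 1 - j.val) * ∏ m ∈ Finset.Ico j.val k, spFactor w m else 0

theorem rowsDet_zero (v : ℕ → Fin n → R) (p : Fin n → ℕ) : rowsDet 0 v p = 1 := by
  have : rowsMatrix 0 v p = 1 := by
    funext i j
    simp [rowsMatrix, Matrix.one_apply, Pi.single_apply, eq_comm]
  rw [rowsDet, this, Matrix.det_one]

theorem sum_spFillings (w : Letter n → R) (k : ℕ) (hk : k ≤ n) :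
    ∀ lam : Fin n → ℕ, IsShape k lam →
      ∑ T ∈ spFillings (2 * k) lam, ∏ c, w (T c) =
        rowsDet k (coeffRows (spSeries w k)) (particles k lam) := by
  induction k with
  | zero =>
    intro lam h
    have hc : IsEmpty (Cell lam) := ⟨fun c => by
      have := h.2 c.1 (Nat.zero_le _)
      have := c.2.isLt
      omega⟩
    rw [rowsDet_zero]
    have : spFillings (2 * 0) lam = Finset.univ := by
      ext T
      simp only [mem_spFillings, Finset.mem_univ, iff_true]
      exact ⟨⟨fun c => hc.elim c, fun c => hc.elim c, fun c => hc.elim c⟩, fun c => hc.elim c⟩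
    rw [this]
    simp
  | succ k ih =>
    intro lam h
    set K : Fin n := ⟨k, hk⟩ with hK
    -- The series `1` in column `k` becomes `spFactor w k` once the letters `k̄` and `k` are added,
    -- and the earlier columns acquire `X * spFactor w k`.
    have h0 := sum_spFillings_new_row w K (spSeries w k)
      (fun j => if j < K then X * spSeries w k j else if j = K then 1 else 0)
      (fun j hj => if_neg (by rw [Fin.le_def] at hj; simp only [hK] at hj; omega))
      (fun j hj => if_pos hj) (by simp)
      (fun j hj => by rw [if_neg (not_lt.2 hj.le), if_neg hj.ne'])
      (ih (by omega))
    have h1 := sum_spFillings_geom w ⟨K, true⟩ _ h0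
    have h2 := sum_spFillings_geom w ⟨K, false⟩ _ h1 lam h
    have hr : (⟨K, false⟩ : Letter n).rank + 1 = 2 * (k + 1) := by
      simp [Letter.rank, hK]; ring
    rw [hr] at h2
    rw [h2]
    congr 1
    refine congrArg coeffRows (funext fun j => ?_)
    have hfac : spFactor w k = geom (w ⟨K, false⟩) * geom (w ⟨K, true⟩) := by
      rw [spFactor, dif_pos (show k < n from hk)]
    rw [← mul_assoc, ← hfac]
    have hjK : j < K ↔ j.val < k := Iff.rfl
    have hjK' : j = K ↔ j.val = k := Fin.ext_iff
    simp only [hjK, hjK', spSeries]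
    rcases lt_trichotomy j.val k with hj | hj | hj
    · rw [if_pos hj, if_pos hj, if_pos (by omega), Finset.prod_Ico_succ_top hj.le,
        show k + 1 - 1 - j.val = (k - 1 - j.val) + 1 by omega, pow_succ]
      ring
    · rw [if_neg (by omega), if_pos hj, if_pos (by omega), hj]
      simp
    · rw [if_neg (by omega), if_neg (by omega), if_neg (by omega), mul_zero]

theorem sum_symplecticTableaux (w : Letter n → R) {lam : Fin n → ℕ} (h : Antitone lam) :
    ∑ T ∈ symplecticTableaux lam, ∏ c, w (T c) =
      rowsDet n (coeffRows (spSeries w n)) (particles n lam) := by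
  rw [← sum_spFillings w n le_rfl lam ⟨h, fun i hi => by have := i.isLt; omega⟩]
  refine Finset.sum_congr ?_ fun _ _ => rfl
  ext T
  simp only [mem_spFillings, symplecticTableaux, Finset.mem_filter, Finset.mem_univ, true_and]
  refine ⟨fun hT => ⟨hT, fun c => ?_⟩, And.left⟩
  have := (T c).idx.isLt
  simp only [Letter.rank]
  split_ifs <;> omega

end Symplectic

/-! ### The determinant for primed shifted tableaux -/

section Shifted

open PowerSeries

variable {R : Type*} [CommRing R] {n : ℕ}

open Classical in
/-- The primed shifted tableaux of shape `mu` whose entries have rank `< r`. -/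
noncomputable def qstFillings (r : ℕ) (mu : Fin n → ℕ) : Finset (Cell mu → PrimedLetter n) :=
  Finset.univ.filter fun S => IsQST S ∧ ∀ c, (S c).rank < r

theorem mem_qstFillings {r : ℕ} {mu : Fin n → ℕ} {S : Cell mu → PrimedLetter n} :
    S ∈ qstFillings r mu ↔ IsQST S ∧ ∀ c, (S c).rank < r := by
  simp [qstFillings]

/-- Strictly decreasing sequences in the first `m` rows, with zero entries below. -/
def IsStrictShape (m : ℕ) (mu : Fin n → ℕ) : Prop :=
  StrictDecr m mu ∧ ∀ i, m ≤ i.val → mu i = 0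

/-- In a shifted diagram this says that every box of row `j` has a box of row `i` above it in the
same column. -/
theorem StrictDecr.add_sub_le {m : ℕ} {mu : Fin n → ℕ} (h : StrictDecr m mu) {i j : Fin n}
    (hij : i ≤ j) (hj : j.val < m) : mu j + (j.val - i.val) ≤ mu i := by
  obtain ⟨d, hd⟩ := Nat.exists_eq_add_of_le (Fin.le_def.1 hij)
  induction d generalizing j with
  | zero =>
    have : j = i := Fin.ext hd
    subst this
    omega
  | succ d ih =>
    have hlt := j.isLt
    have h1 := @ih ⟨i.val + d, by omega⟩ (by simp [Fin.le_def]) (by simp only; omega) rfl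
    have h2 := h ⟨i.val + d, by omega⟩ j (by rw [Fin.lt_def]; simp only; omega) hj
    simp only at h1
    omega

theorem IsStrictShape.lt_of_pos {m : ℕ} {mu : Fin n → ℕ} (h : IsStrictShape m mu) {i : Fin n}
    (hi : 0 < mu i) : i.val < m := by
  by_contra hcon
  have := h.2 i (by omega)
  omega

theorem IsQST.rank_le {mu : Fin n → ℕ} {S : Cell mu → PrimedLetter n} (hS : IsQST S)
    (c d : Cell mu) (h : c.1 = d.1) (h' : c.2.val < d.2.val) : (S c).rank ≤ (S d).rank :=
  hS.row_weak c d h (by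
    have : c.1.val = d.1.val := congrArg Fin.val h
    simp only [Cell.shiftedCol]; omega)

theorem IsQST.restrict {mu nu : Fin n → ℕ} {S : Cell mu → PrimedLetter n}
    (hS : IsQST S) (h : ∀ i, nu i ≤ mu i) : IsQST (restrictFilling h S) := by
  have hinj : ∀ c d : Cell nu, c ≠ d →
      (⟨c.1, Fin.castLE (h c.1) c.2⟩ : Cell mu) ≠ ⟨d.1, Fin.castLE (h d.1) d.2⟩ := by
    rintro ⟨i, j⟩ ⟨i', j'⟩ hne heq
    apply hne
    obtain ⟨h1, h2⟩ := Sigma.mk.inj_iff.1 heq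
    simp only at h1
    subst h1
    congr 1
    have := congrArg Fin.val (eq_of_heq h2)
    exact Fin.ext this
  exact
  { row_weak := fun _ _ h1 h2 => hS.row_weak _ _ h1 h2
    col_weak := fun _ _ h1 h2 => hS.col_weak _ _ h1 h2
    col_unprimed := fun c d h1 h2 h3 => hS.col_unprimed _ _ h1 (hinj c d h2) h3
    row_primed := fun c d h1 h2 h3 => hS.row_primed _ _ h1 (hinj c d h2) h3
    diag := fun c hc => hS.diag ⟨c.1, Fin.castLE (h c.1) c.2⟩ hc }

/-- The strict shapes `nu` for which the letter `a` may fill `mu / nu`. -/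
def IsStrip (a : PrimedLetter n) (mu nu : Fin n → ℕ) : Prop :=
  (∀ i, nu i ≤ mu i) ∧ IsStrictShape (a.idx.val + 1) nu ∧
    (a.primed = false → ∀ i j : Fin n, i < j → j.val < a.idx.val + 1 → mu j < nu i) ∧
    (a.primed = true → ∀ i, mu i ≤ nu i + 1)

theorem IsQST.extend {mu nu : Fin n → ℕ} {S : Cell nu → PrimedLetter n} {a : PrimedLetter n}
    (hS : IsQST S) (hmu : IsStrictShape (a.idx.val + 1) mu) (hnu : IsStrip a mu nu)
    (ha : ∀ c, S c < a) : IsQST (extendFilling (mu := mu) a S) := by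
  obtain ⟨hle, hs, hu, hp⟩ := hnu
  have hlow : ∀ c d : Cell mu, c.shiftedCol = d.shiftedCol → c.row < d.row →
      d.2.val < nu d.1 → c.2.val < nu c.1 := by
    rintro ⟨i, j⟩ ⟨i', j'⟩ (h1 : i.val + j.val = i'.val + j'.val) (h2 : i.val < i'.val) h3
    have := hs.1.add_sub_le (show i ≤ i' from h2.le) (hs.lt_of_pos (Nat.zero_lt_of_lt h3))
    simp only at h3 ⊢
    omega
  -- For unprimed `a`, a box lying above another box of `mu` in its column already belongs to `nu`,
  -- so `a` is added at most once per column.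
  have hnew : ∀ c d : Cell mu, c.shiftedCol = d.shiftedCol → c.row < d.row →
      a.primed = false → c.2.val < nu c.1 := by
    rintro ⟨i, j⟩ ⟨i', j'⟩ (h1 : i.val + j.val = i'.val + j'.val) (h2 : i.val < i'.val) h3
    have hj' := j'.isLt
    have hlt := i'.isLt
    have h4 := hmu.lt_of_pos (Nat.zero_lt_of_lt hj')
    have h5 := hu h3 i ⟨i.val + 1, by omega⟩ (by simp [Fin.lt_def]) (by simp only; omega)
    have h6 := hmu.1.add_sub_le (i := ⟨i.val + 1, by omega⟩) (j := i')
      (by rw [Fin.le_def]; simp only; omega) h4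
    simp only at h6 ⊢
    omega
  have hSa : ∀ c, S c ≠ a := fun c => (ha c).ne
  constructor
  · rintro ⟨i, j⟩ ⟨i', j'⟩ (rfl : i = i') (h2 : i.val + j.val < i.val + j'.val)
    by_cases hd : j'.val < nu i
    · rw [extendFilling_of_lt (c := ⟨i, j'⟩) hd,
        extendFilling_of_lt (c := ⟨i, j⟩) (show j.val < nu i by omega)]
      exact hS.row_weak _ _ rfl h2
    · rw [extendFilling_of_le (c := ⟨i, j'⟩) (not_lt.1 hd)]
      by_cases hc : j.val < nu i
      · rw [extendFilling_of_lt hc]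
        exact (ha _).le
      · rw [extendFilling_of_le (not_lt.1 hc)]
  · intro c d h1 h2
    by_cases hd : d.2.val < nu d.1
    · rw [extendFilling_of_lt hd, extendFilling_of_lt (hlow c d h1 h2 hd)]
      exact hS.col_weak _ _ h1 h2
    · rw [extendFilling_of_le (c := d) (not_lt.1 hd)]
      by_cases hc : c.2.val < nu c.1
      · rw [extendFilling_of_lt hc]
        exact (ha _).le
      · rw [extendFilling_of_le (not_lt.1 hc)]
  · rintro ⟨i, j⟩ ⟨i', j'⟩ h1 h2
    by_cases hc : j.val < nu i <;> by_cases hd : j'.val < nu i'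
    · rw [extendFilling_of_lt (c := ⟨i, j⟩) hc, extendFilling_of_lt (c := ⟨i', j'⟩) hd]
      refine hS.col_unprimed _ _ h1 fun heq => h2 ?_
      obtain ⟨h3, h4⟩ := Sigma.mk.inj_iff.1 heq
      simp only at h3
      subst h3
      congr 1
      have h5 := eq_of_heq h4
      exact Fin.ext (Fin.mk.inj_iff.1 h5)
    · rw [extendFilling_of_lt (c := ⟨i, j⟩) hc,
        extendFilling_of_le (c := ⟨i', j'⟩) (not_lt.1 hd)]
      exact fun _ => hSa _
    · rw [extendFilling_of_le (c := ⟨i, j⟩) (not_lt.1 hc),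
        extendFilling_of_lt (c := ⟨i', j'⟩) hd]
      exact fun _ => (hSa _).symm
    · rw [extendFilling_of_le (c := ⟨i, j⟩) (not_lt.1 hc)]
      intro h3
      exfalso
      rcases lt_trichotomy i i' with hlt | rfl | hlt
      · exact hc (hnew _ _ h1 hlt h3)
      · apply h2
        congr 1
        have h1' : i.val + j.val = i.val + j'.val := h1
        exact Fin.ext (by omega)
      · exact hd (hnew _ _ h1.symm hlt h3)
  · rintro ⟨i, j⟩ ⟨i', j'⟩ (rfl : i = i') h2
    by_cases hc : j.val < nu i <;> by_cases hd : j'.val < nu i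
    · rw [extendFilling_of_lt (c := ⟨i, j⟩) hc, extendFilling_of_lt (c := ⟨i, j'⟩) hd]
      refine hS.row_primed _ _ rfl fun heq => h2 ?_
      obtain ⟨h3, h4⟩ := Sigma.mk.inj_iff.1 heq
      congr 1
      have h5 := eq_of_heq h4
      exact Fin.ext (Fin.mk.inj_iff.1 h5)
    · rw [extendFilling_of_lt (c := ⟨i, j⟩) hc,
        extendFilling_of_le (c := ⟨i, j'⟩) (not_lt.1 hd)]
      exact fun _ => hSa _
    · rw [extendFilling_of_le (c := ⟨i, j⟩) (not_lt.1 hc),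
        extendFilling_of_lt (c := ⟨i, j'⟩) hd]
      exact fun _ => (hSa _).symm
    · rw [extendFilling_of_le (c := ⟨i, j⟩) (not_lt.1 hc)]
      intro h3
      exfalso
      apply h2
      congr 1
      have := hp h3 i
      have := j.isLt
      have := j'.isLt
      exact Fin.ext (by omega)
  · rintro ⟨i, j⟩ (h1 : i.val + j.val = i.val)
    by_cases hc : j.val < nu i
    · rw [extendFilling_of_lt (c := ⟨i, j⟩) hc]
      exact hS.diag ⟨i, ⟨j, hc⟩⟩ h1
    · rw [extendFilling_of_le (c := ⟨i, j⟩) (not_lt.1 hc)]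
      have hj := j.isLt
      have h2 := hmu.lt_of_pos (Nat.zero_lt_of_lt hj)
      change a.idx = i
      by_contra hne
      have h3 : i.val < a.idx.val := by
        have : a.idx.val ≠ i.val := fun h => hne (Fin.ext h)
        omega
      -- A new diagonal box in row `i` means `nu i = 0`. Strictness of `nu` in rows up to `a.idx`
      -- then leaves only `i = a.idx`.
      have h4 := hs.1 i a.idx h3 (Nat.lt_succ_self _)
      omega

theorem IsQST.isStrip_subShape {mu : Fin n → ℕ} {S : Cell mu → PrimedLetter n}
    {a : PrimedLetter n} (hS : IsQST S) (hmu : IsStrictShape (a.idx.val + 1) mu)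
    (hr : ∀ c, (S c).rank < a.rank + 1) :
    IsStrip a mu (subShape PrimedLetter.rank a.rank S) := by
  have hlt := lt_subShape_iff hS.rank_le a.rank
  have heq : ∀ c : Cell mu, ¬ (S c).rank < a.rank → S c = a := fun c hc =>
    PrimedLetter.rank_injective (by have := hr c; omega)
  set nu := subShape PrimedLetter.rank a.rank S with hnu
  have hle : ∀ i, nu i ≤ mu i := subShape_le _ _ _
  -- Rows before `a.idx` keep at least their diagonal box, whose entry has too small an index to
  -- equal `a`. This settles the strict inequalities in which the lower row is empty.
  have hpos : ∀ i j : Fin n, i < j → j.val < a.idx.val + 1 → 0 < nu i := by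
    intro i j hij hj
    have h1 := hmu.1 i j hij hj
    have hij' : i.val < j.val := hij
    have h2 := hS.diag ⟨i, ⟨0, by omega⟩⟩ rfl
    refine (hlt i ⟨0, by omega⟩).2 ?_
    have h3 : (S ⟨i, ⟨0, by omega⟩⟩).idx.val = i.val := congrArg Fin.val h2
    simp only [PrimedLetter.rank, h3]
    split_ifs <;> omega
  have hcol : ∀ i j : Fin n, ∀ hij : i < j, ∀ hj : j.val < a.idx.val + 1, ∀ l, ∀ hl : l < mu j,
      ∃ hl' : j.val - i.val + l < mu i, S ⟨i, ⟨j.val - i.val + l, hl'⟩⟩ ≤ S ⟨j, ⟨l, hl⟩⟩ := by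
    intro i j hij hj l hl
    have h1 := hmu.1.add_sub_le hij.le hj
    refine ⟨by omega, hS.col_weak _ _ ?_ hij⟩
    have hij' : i.val < j.val := hij
    simp only [Cell.shiftedCol]
    omega
  refine ⟨hle, ⟨fun i j hij hj => ?_, fun i hi => ?_⟩, fun ha i j hij hj => ?_, fun ha i => ?_⟩
  · rcases Nat.eq_zero_or_pos (nu j) with h0 | h0
    · rw [h0]
      exact hpos i j hij hj
    -- The box in row `i` above the last `a`-free box of row `j` is also `a`-free, and its position
    -- in the row is larger by `j - i`.
    · have hlj : nu j - 1 < mu j := by have := hle j; omega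
      obtain ⟨hl', h1⟩ := hcol i j hij hj (nu j - 1) hlj
      have h2 := (hlt j ⟨nu j - 1, hlj⟩).1 (by simp only; omega)
      have h3 := (hlt i ⟨_, hl'⟩).2 (lt_of_le_of_lt h1 h2)
      have hij' : i.val < j.val := hij
      simp only at h3
      omega
  · have := hle i
    have := hmu.2 i hi
    omega
  · rcases Nat.eq_zero_or_pos (mu j) with h0 | h0
    · rw [h0]
      exact hpos i j hij hj
    · have hij' : i.val < j.val := hij
      obtain ⟨hl', h1⟩ := hcol i j hij hj (mu j - 1) (by omega)
      -- If `nu i ≤ mu j`, then the last box of row `j` and the box of row `i` above it both contain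
      -- the unprimed letter `a`.
      by_contra hcon
      have h2 : ¬ (S ⟨i, ⟨_, hl'⟩⟩).rank < a.rank := by
        rw [← hlt]
        simp only
        omega
      have h3 : ¬ (S ⟨j, ⟨mu j - 1, by omega⟩⟩).rank < a.rank := fun h =>
        h2 (lt_of_le_of_lt h1 h)
      refine hS.col_unprimed ⟨i, ⟨_, hl'⟩⟩ ⟨j, ⟨mu j - 1, by omega⟩⟩ ?_ ?_ ?_ ?_
      · simp only [Cell.shiftedCol]
        omega
      · intro h
        exact hij.ne (congrArg Sigma.fst h)
      · rw [heq _ h2, ha]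
      · rw [heq _ h2, heq _ h3]
  · by_contra hcon
    have h1 := heq ⟨i, ⟨nu i, by omega⟩⟩ (by rw [← hlt]; simp)
    have h2 := heq ⟨i, ⟨nu i + 1, by omega⟩⟩ (by rw [← hlt]; simp)
    refine hS.row_primed ⟨i, ⟨nu i, by omega⟩⟩ ⟨i, ⟨nu i + 1, by omega⟩⟩ rfl ?_ ?_ ?_
    · intro h
      have := eq_of_heq (Sigma.mk.inj_iff.1 h).2
      simp at this
    · rw [h1, ha]
    · rw [h1, h2]

/-- The index set is abstract, so that it can be `horizontalStrips` for an unprimed letter and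
`verticalStrips` for a primed one. -/
theorem sum_qstFillings_succ (w : PrimedLetter n → R) (a : PrimedLetter n) {mu : Fin n → ℕ}
    (h : IsStrictShape (a.idx.val + 1) mu) (A : Finset (Fin n → ℕ))
    (hA : ∀ nu, nu ∈ A ↔ IsStrip a mu nu) :
    ∑ S ∈ qstFillings (a.rank + 1) mu, ∏ c, w (S c) =
      ∑ nu ∈ A, (∏ i, w a ^ (mu i - nu i)) *
        ∑ S ∈ qstFillings a.rank nu, ∏ c, w (S c) := by
  refine sum_fillings_eq_sum_subshapes w a _ _ _ (fun nu hnu => ((hA nu).1 hnu).1) ?_ ?_ ?_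
  · intro S hS
    rw [mem_qstFillings] at hS
    obtain ⟨hS, hr⟩ := hS
    refine ⟨_, (hA _).2 (hS.isStrip_subShape h hr), _, ?_,
      eq_extendFilling PrimedLetter.rank_injective hS.rank_le a hr⟩
    rw [mem_qstFillings]
    exact ⟨hS.restrict _, fun c => (lt_subShape_iff hS.rank_le a.rank c.1 _).1 c.2.isLt⟩
  · intro nu hnu S hS
    rw [mem_qstFillings] at hS ⊢
    refine ⟨hS.1.extend h ((hA nu).1 hnu) hS.2, fun c => ?_⟩
    by_cases hc : c.2.val < nu c.1
    · rw [extendFilling_of_lt hc]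
      exact (hS.2 _).trans (Nat.lt_succ_self _)
    · rw [extendFilling_of_le (not_lt.1 hc)]
      exact Nat.lt_succ_self _
  · intro nu _ S hS c hc
    have := (mem_qstFillings.1 hS).2 c
    rw [hc] at this
    exact lt_irrefl _ this

theorem sum_qstFillings_geom (w : PrimedLetter n → R) (a : PrimedLetter n)
    (ha : a.primed = false) (f : Fin n → R⟦X⟧)
    (IH : ∀ mu : Fin n → ℕ, IsStrictShape (a.idx.val + 1) mu →
      ∑ S ∈ qstFillings a.rank mu, ∏ c, w (S c) = rowsDet (a.idx.val + 1) (coeffRows f) mu)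
    (mu : Fin n → ℕ) (h : IsStrictShape (a.idx.val + 1) mu) :
    ∑ S ∈ qstFillings (a.rank + 1) mu, ∏ c, w (S c) =
      rowsDet (a.idx.val + 1) (coeffRows fun j => geom (w a) * f j) mu := by
  have hA : ∀ nu, nu ∈ horizontalStrips (a.idx.val + 1) mu ↔ IsStrip a mu nu := by
    intro nu
    rw [mem_horizontalStrips]
    refine ⟨fun ⟨h1, h2, h3⟩ => ⟨h1, ⟨fun i j hij hj => (h1 j).trans_lt (h3 i j hij hj),
      fun i hi => (h2 i hi).trans (h.2 i hi)⟩, fun _ => h3, fun h4 => ?_⟩,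
      fun ⟨h1, h2, h3, _⟩ => ⟨h1, fun i hi => (h2.2 i hi).trans (h.2 i hi).symm, h3 ha⟩⟩
    rw [ha] at h4
    exact absurd h4 (by decide)
  rw [sum_qstFillings_succ w a h _ hA, rowsDet_geom _ _ _ _ (coeffRows_geom_zero (w a) f)
    (coeffRows_geom_succ (w a) f) _ h.1]
  exact Finset.sum_congr rfl fun nu hnu => by rw [IH nu ((hA nu).1 hnu).2.1]

theorem sum_qstFillings_linear (w : PrimedLetter n → R) (a : PrimedLetter n)
    (ha : a.primed = true) (f : Fin n → R⟦X⟧)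
    (IH : ∀ mu : Fin n → ℕ, IsStrictShape (a.idx.val + 1) mu →
      ∑ S ∈ qstFillings a.rank mu, ∏ c, w (S c) = rowsDet (a.idx.val + 1) (coeffRows f) mu)
    (mu : Fin n → ℕ) (h : IsStrictShape (a.idx.val + 1) mu) :
    ∑ S ∈ qstFillings (a.rank + 1) mu, ∏ c, w (S c) =
      rowsDet (a.idx.val + 1) (coeffRows fun j => (1 + C (w a) * X) * f j) mu := by
  have hA : ∀ nu, nu ∈ verticalStrips (a.idx.val + 1) mu ↔ IsStrip a mu nu := by
    intro nu
    rw [mem_verticalStrips]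
    refine ⟨fun ⟨h1, h2, h3, h4⟩ => ⟨h1, ⟨h4, fun i hi => (h2 i hi).trans (h.2 i hi)⟩,
      fun h5 => ?_, fun _ => h3⟩,
      fun ⟨h1, h2, _, h4⟩ => ⟨h1, fun i hi => (h2.2 i hi).trans (h.2 i hi).symm, h4 ha, h2.1⟩⟩
    rw [ha] at h5
    exact absurd h5 (by decide)
  rw [sum_qstFillings_succ w a h _ hA, rowsDet_linear _ _ _ _ (coeffRows_linear_zero (w a) f)
    (coeffRows_linear_succ (w a) f) _ h.1]
  exact Finset.sum_congr rfl fun nu hnu => by rw [IH nu ((hA nu).1 hnu).2.1]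

/-- The strict parts are themselves the particle positions, so no factor `X` is needed. If `mu k =
0`, row `k` reads constant terms; these vanish before column `k` by `hf0`, so the unit row is
recovered. If `mu k > 0`, the `k`-th diagonal entry would need index `k`, so there are no fillings,
while column `k` reads the series `1` only in positive degrees. Strictness makes the parts above row
`k` positive, so the induction hypothesis is needed only for such shapes. -/
theorem sum_qstFillings_new_row (w : PrimedLetter n → R) (k : Fin n) (f f' : Fin n → R⟦X⟧)
    (hf : ∀ j : Fin n, k ≤ j → f j = 0) (hf0 : ∀ j, constantCoeff (f j) = 0)
    (hf1 : ∀ j : Fin n, j < k → f' j = f j) (hf2 : f' k = 1)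
    (hf3 : ∀ j : Fin n, k < j → f' j = 0)
    (IH : ∀ mu : Fin n → ℕ, IsStrictShape k.val mu → (∀ i, i < k → 0 < mu i) →
      ∑ S ∈ qstFillings (4 * k.val) mu, ∏ c, w (S c) = rowsDet k.val (coeffRows f) mu)
    (mu : Fin n → ℕ) (h : IsStrictShape (k.val + 1) mu) :
    ∑ S ∈ qstFillings (4 * k.val) mu, ∏ c, w (S c) =
      rowsDet (k.val + 1) (coeffRows f') mu := by
  have hgt : ∀ i, i < k → mu k < mu i := fun i hi => h.1 i k hi (Nat.lt_succ_self _)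
  by_cases hk : mu k = 0
  · rw [IH mu ⟨fun i j hij hj => h.1 i j hij (by omega), fun i hi => ?_⟩
      fun i hi => Nat.zero_lt_of_lt (hgt i hi)]
    · unfold rowsDet
      congr 1
      funext i j
      simp only [rowsMatrix]
      rcases lt_trichotomy i k with hik | rfl | hik
      · have hik' : i.val < k.val := hik
        rw [if_pos hik', if_pos (by omega)]
        simp only [coeffRows]
        rcases lt_trichotomy j k with hjk | rfl | hjk
        · rw [hf1 j hjk]
        · have := hgt i hik
          rw [hf2, hf j le_rfl, coeff_one, if_neg (by omega), map_zero]
        · rw [hf3 j hjk, hf j hjk.le]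
      · rw [if_neg (by omega), if_pos (by omega)]
        simp only [coeffRows, hk]
        rcases lt_trichotomy j i with hjk | rfl | hjk
        · rw [hf1 j hjk, Pi.single_eq_of_ne hjk.ne, coeff_zero_eq_constantCoeff_apply, hf0]
        · rw [hf2, Pi.single_eq_same]
          simp
        · rw [hf3 j hjk, Pi.single_eq_of_ne hjk.ne', map_zero]
      · have hik' : k.val < i.val := hik
        rw [if_neg (by omega), if_neg (by omega)]
    · rcases eq_or_lt_of_le (show k ≤ i from hi) with rfl | hlt
      · exact hk
      · exact h.2 i hlt
  · have hempty : qstFillings (4 * k.val) mu = ∅ := by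
      rw [Finset.eq_empty_iff_forall_notMem]
      intro S hS
      rw [mem_qstFillings] at hS
      have h1 := congrArg Fin.val (hS.1.diag ⟨k, ⟨0, by omega⟩⟩ rfl)
      have h2 := hS.2 ⟨k, ⟨0, by omega⟩⟩
      simp only [Cell.row, PrimedLetter.rank] at h1 h2
      omega
    rw [hempty, Finset.sum_empty, rowsDet]
    symm
    refine Matrix.det_eq_zero_of_column_eq_zero k fun i => ?_
    simp only [rowsMatrix]
    split_ifs with hik
    · simp only [coeffRows, hf2, coeff_one]
      rw [if_neg]
      rcases eq_or_lt_of_le (show i ≤ k from Nat.lt_succ_iff.1 hik) with rfl | hlt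
      · exact hk
      · have := hgt i hlt
        omega
    · exact Pi.single_eq_of_ne (by rintro rfl; omega) _

/-- The factor contributed by the four letters of index `k`. -/
noncomputable def qFactor (w : PrimedLetter n → R) (k : ℕ) : R⟦X⟧ :=
  if h : k < n then
    geom (w ⟨⟨k, h⟩, false, false⟩) * ((1 + C (w ⟨⟨k, h⟩, false, true⟩) * X) *
      (geom (w ⟨⟨k, h⟩, true, false⟩) * (1 + C (w ⟨⟨k, h⟩, true, true⟩) * X)))
  else 1

theorem constantCoeff_qFactor (w : PrimedLetter n → R) (k : ℕ) :
    constantCoeff (qFactor w k) = 1 := by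
  have hg : ∀ a : R, constantCoeff (geom a) = 1 := fun a => by
    rw [← coeff_zero_eq_constantCoeff_apply]; simp [geom]
  unfold qFactor
  split_ifs <;> simp [hg]

/-- Columns of the determinant for primed shifted tableaux with letters of index `< k`. -/
noncomputable def qSeries (w : PrimedLetter n → R) (k : ℕ) (j : Fin n) : R⟦X⟧ :=
  if j.val < k then (qFactor w j.val - 1) * ∏ m ∈ Finset.Ico (j.val + 1) k, qFactor w m else 0

theorem constantCoeff_qSeries (w : PrimedLetter n → R) (k : ℕ) (j : Fin n) :
    constantCoeff (qSeries w k j) = 0 := by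
  unfold qSeries
  split_ifs
  · simp [constantCoeff_qFactor]
  · simp

theorem sum_qstFillings (w : PrimedLetter n → R) (k : ℕ) (hk : k ≤ n) :
    ∀ mu : Fin n → ℕ, IsStrictShape k mu → (∀ i : Fin n, i.val < k → 0 < mu i) →
      ∑ S ∈ qstFillings (4 * k) mu, ∏ c, w (S c) =
        rowsDet k (coeffRows (qSeries w k)) mu := by
  induction k with
  | zero =>
    intro mu h _
    have hc : IsEmpty (Cell mu) := ⟨fun c => by
      have := h.2 c.1 (Nat.zero_le _)
      have := c.2.isLt
      omega⟩
    rw [rowsDet_zero]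
    have : qstFillings (4 * 0) mu = Finset.univ := by
      ext S
      simp only [mem_qstFillings, Finset.mem_univ, iff_true]
      exact ⟨⟨fun c => hc.elim c, fun c => hc.elim c, fun c => hc.elim c, fun c => hc.elim c,
        fun c => hc.elim c⟩, fun c => hc.elim c⟩
    rw [this]
    simp
  | succ k ih =>
    intro mu h hpos
    set K : Fin n := ⟨k, hk⟩ with hK
    have h0 := sum_qstFillings_new_row w K (qSeries w k)
      (fun j => if j < K then qSeries w k j else if j = K then 1 else 0)
      (fun j hj => if_neg (by rw [Fin.le_def] at hj; simp only [hK] at hj; omega))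
      (constantCoeff_qSeries w k)
      (fun j hj => if_pos hj) (by simp)
      (fun j hj => by rw [if_neg (not_lt.2 hj.le), if_neg hj.ne'])
      (ih (by omega))
    have h1 := sum_qstFillings_linear w ⟨K, true, true⟩ rfl _ h0
    have h2 := sum_qstFillings_geom w ⟨K, true, false⟩ rfl _ h1
    have h3 := sum_qstFillings_linear w ⟨K, false, true⟩ rfl _ h2
    have h4 := sum_qstFillings_geom w ⟨K, false, false⟩ rfl _ h3 mu h
    have hr : (⟨K, false, false⟩ : PrimedLetter n).rank + 1 = 4 * (k + 1) := by
      simp [PrimedLetter.rank, hK]; ring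
    rw [hr] at h4
    rw [h4]
    unfold rowsDet
    congr 1
    -- The series obtained and those of `qSeries` agree only in positive degrees, so the matrices
    -- are compared entry by entry.
    funext i j
    simp only [rowsMatrix]
    change (if i.val < k + 1 then _ else _ : Fin n → R) j = _
    split_ifs with hi
    · have hfac : qFactor w k = geom (w ⟨K, false, false⟩) * ((1 + C (w ⟨K, false, true⟩) * X) *
          (geom (w ⟨K, true, false⟩) * (1 + C (w ⟨K, true, true⟩) * X))) := by
        rw [qFactor, dif_pos (show k < n from hk)]
      have hjK : j < K ↔ j.val < k := Iff.rfl
      have hjK' : j = K ↔ j.val = k := Fin.ext_iff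
      have hassoc : ∀ b : R⟦X⟧, geom (w ⟨K, false, false⟩) * ((1 + C (w ⟨K, false, true⟩) * X) *
          (geom (w ⟨K, true, false⟩) * ((1 + C (w ⟨K, true, true⟩) * X) * b))) =
            qFactor w k * b := by
        intro b; rw [hfac]; ring
      simp only [coeffRows, hassoc, hjK, hjK', qSeries]
      rcases lt_trichotomy j.val k with hj | hj | hj
      · rw [if_pos hj, if_pos hj, if_pos (by omega), Finset.prod_Ico_succ_top (by omega)]
        congr 1
        ring
      -- Column `k` is `qFactor w k`, whereas `qSeries` subtracts `1` to remove the constant term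
      -- for the next stage. The difference is invisible because the parts `mu i` of the active rows
      -- are positive.
      · rw [if_neg (by omega), if_pos hj, if_pos (by omega), hj]
        have := hpos i hi
        simp only [mul_one, Finset.Ico_self, Finset.prod_empty, map_sub, coeff_one]
        rw [if_neg (by omega), sub_zero]
      · rw [if_neg (by omega), if_neg (by omega), if_neg (by omega), mul_zero]
    · rfl

theorem sum_QST (w : PrimedLetter n → R) {mu : Fin n → ℕ} (h : StrictDecr n mu)
    (hpos : ∀ i, 0 < mu i) :
    ∑ S ∈ QST mu, ∏ c, w (S c) = rowsDet n (coeffRows (qSeries w n)) mu := by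
  rw [← sum_qstFillings w n le_rfl mu ⟨h, fun i hi => by have := i.isLt; omega⟩
    fun i _ => hpos i]
  refine Finset.sum_congr ?_ fun _ _ => rfl
  ext S
  simp only [mem_qstFillings, QST, Finset.mem_filter, Finset.mem_univ, true_and]
  refine ⟨fun hS => ⟨hS, fun c => ?_⟩, And.left⟩
  have := (S c).idx.isLt
  simp only [PrimedLetter.rank]
  split_ifs <;> omega

end Shifted

/-! ### The triangular factorization and the product -/

section Factorization

open PowerSeries

variable {R : Type*} [CommRing R] {n : ℕ}

/-- The inverse of `geom a * geom b` is `1 - (a + b) X + p X²`. It differs from the quadratic factor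
only in the linear term, because both have the same coefficient `p`. -/
theorem linear_mul_geom_pair (a b r p : R) (hp : a * b = p) :
    (1 + C r * X + C p * X ^ 2) * (geom a * geom b) =
      1 + C (a + b + r) * X * (geom a * geom b) := by
  have ha := geom_mul_one_sub a
  have hb := geom_mul_one_sub b
  have h : (geom a * (1 - C a * X)) * (geom b * (1 - C b * X)) = 1 := by rw [ha, hb, one_mul]
  rw [← hp]
  simp only [map_add, map_mul]
  linear_combination h

/-- Expansion in the family `z ^ (d - e) K (j + e)` of a product of `d` quadratic factors
with `K j`. -/
theorem exists_triangular_expansion (K : ℕ → R⟦X⟧) (s r : ℕ → R) (p : R)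
    (hK : ∀ l < n, ∀ ρ : R, (1 + C ρ * X + C p * X ^ 2) * K l =
      K (l + 1) + C (s l + ρ) * X * K l) (j d : ℕ) (hd : j + d < n) :
    ∃ c : ℕ → R, c 0 = ∏ m ∈ Finset.Ico (j + 1) (j + 1 + d), (s j + r m) ∧
      (∏ m ∈ Finset.Ico (j + 1) (j + 1 + d), (1 + C (r m) * X + C p * X ^ 2)) * K j =
        ∑ e ∈ Finset.range (d + 1), C (c e) * (X ^ (d - e) * K (j + e)) := by
  induction d with
  | zero => exact ⟨fun _ => 1, by simp, by simp⟩
  | succ d ih =>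
    obtain ⟨c, hc0, hc⟩ := ih (by omega)
    set ρ := r (j + 1 + d) with hρ
    -- By `hK`, one more quadratic factor splits each term in two: `K (j + e)` stays with an extra
    -- `X` and the scalar `s (j + e) + ρ`, or it advances to `K (j + e + 1)`. Only the first kind
    -- contributes to `e = 0`.
    refine ⟨fun e => (if e ≤ d then c e * (s (j + e) + ρ) else 0) +
      (if e = 0 then 0 else c (e - 1)), ?_, ?_⟩
    · rw [← add_assoc, Finset.prod_Ico_succ_top (by omega), ← hc0]
      simp [hρ]
    · rw [← add_assoc (j + 1), Finset.prod_Ico_succ_top (by omega), mul_right_comm, hc,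
        Finset.sum_mul]
      have h1 : ∀ e ∈ Finset.range (d + 1),
          C (c e) * (X ^ (d - e) * K (j + e)) * (1 + C (r (j + 1 + d)) * X + C p * X ^ 2) =
            C (c e * (s (j + e) + ρ)) * (X ^ (d + 1 - e) * K (j + e)) +
              C (c e) * (X ^ (d - e) * K (j + e + 1)) := by
        intro e he
        rw [Finset.mem_range] at he
        rw [show d + 1 - e = d - e + 1 by omega, pow_succ, map_mul]
        linear_combination C (c e) * X ^ (d - e) * hK (j + e) (by omega) ρ
      rw [Finset.sum_congr rfl h1, Finset.sum_add_distrib]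
      simp only [map_add, add_mul, Finset.sum_add_distrib]
      congr 1
      · rw [Finset.sum_range_succ _ (d + 1), if_neg (by omega), map_zero, zero_mul, add_zero]
        refine Finset.sum_congr rfl fun e he => ?_
        rw [Finset.mem_range] at he
        rw [if_pos (by omega)]
      · rw [Finset.sum_range_succ' _ (d + 1)]
        simp [add_assoc]

/-- Weights of the unprimed letters. -/
def unprimedWeight (w : PrimedLetter n → R) : Letter n → R := fun a => w ⟨a.idx, a.barred, false⟩

/-- The shifted coefficient matrix is the symplectic one times a lower triangular matrix `N` that
expresses the columns `qSeries` through the columns `spSeries`. -/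
theorem rowsDet_qSeries (w : PrimedLetter n → R) (p : R)
    (hx : ∀ k, w ⟨k, false, false⟩ * w ⟨k, true, false⟩ = p)
    (hy : ∀ k, w ⟨k, false, true⟩ * w ⟨k, true, true⟩ = p) (lam : Fin n → ℕ) :
    rowsDet n (coeffRows (qSeries w n)) (lam + delta n) =
      rowsDet n (coeffRows (spSeries (unprimedWeight w) n)) (particles n lam) *
        ∏ i : Fin n, ∏ j ∈ Finset.Ici i,
          (w ⟨i, false, false⟩ + w ⟨i, true, false⟩ +
            (w ⟨j, false, true⟩ + w ⟨j, true, true⟩)) := by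
  set g := spFactor (unprimedWeight w) with hg
  set s : ℕ → R := fun m => if h : m < n then
    w ⟨⟨m, h⟩, false, false⟩ + w ⟨⟨m, h⟩, true, false⟩ else 0 with hs
  set r : ℕ → R := fun m => if h : m < n then
    w ⟨⟨m, h⟩, false, true⟩ + w ⟨⟨m, h⟩, true, true⟩ else 0 with hr
  set K : ℕ → R⟦X⟧ := fun l => ∏ m ∈ Finset.Ico l n, g m with hKdef
  have hgk : ∀ l < n, ∀ ρ : R, (1 + C ρ * X + C p * X ^ 2) * g l =
      1 + C (s l + ρ) * X * g l := by
    intro l hl ρ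
    rw [hg, hs, spFactor, dif_pos hl]
    simp only [dif_pos hl, unprimedWeight]
    exact linear_mul_geom_pair _ _ _ _ (hx _)
  have hKg : ∀ l < n, K l = g l * K (l + 1) := fun l hl =>
    Finset.prod_eq_prod_Ico_succ_bot hl _
  have hK : ∀ l < n, ∀ ρ : R, (1 + C ρ * X + C p * X ^ 2) * K l =
      K (l + 1) + C (s l + ρ) * X * K l := by
    intro l hl ρ
    rw [hKg l hl]
    linear_combination K (l + 1) * hgk l hl ρ
  have hq : ∀ m < n, qFactor w m = g m * (1 + C (r m) * X + C p * X ^ 2) := by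
    intro m hm
    rw [hg, hr, spFactor, qFactor, dif_pos hm, dif_pos hm]
    simp only [dif_pos hm, unprimedWeight]
    rw [← hy ⟨m, hm⟩, map_add, map_mul]
    ring
  -- Here `qFactor w j - 1` equals `(s j + r j) X g j`, and the quadratic factors of the indices
  -- above `j` are expanded by `exists_triangular_expansion`.
  have hexp : ∀ j : Fin n, ∃ c : ℕ → R,
      c 0 = ∏ m ∈ Finset.Ico (j.val + 1) n, (s j + r m) ∧
      qSeries w n j = C (s j + r j) * (X * ∑ l : Fin n,
        C (if j ≤ l then c (l.val - j.val) else 0) * spSeries (unprimedWeight w) n l) := by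
    intro j
    have hj := j.isLt
    obtain ⟨c, hc0, hc⟩ := exists_triangular_expansion K s r p hK j (n - 1 - j) (by omega)
    rw [show j.val + 1 + (n - 1 - j.val) = n by omega] at hc0 hc
    refine ⟨c, hc0, ?_⟩
    have h1 : ∑ l : Fin n, C (if j ≤ l then c (l.val - j.val) else 0) *
        spSeries (unprimedWeight w) n l =
        ∑ e ∈ Finset.range (n - 1 - j.val + 1), C (c e) * (X ^ (n - 1 - j - e) * K (j + e)) := by
      have h2 : ∀ l : Fin n, C (if j ≤ l then c (l.val - j.val) else 0) *
          spSeries (unprimedWeight w) n l =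
          (fun l : ℕ => if j.val ≤ l then C (c (l - j.val)) * (X ^ (n - 1 - l) * K l) else 0)
            l.val := by
        intro l
        simp only [spSeries, if_pos l.isLt, Fin.le_def]
        split_ifs
        · rfl
        · rw [map_zero, zero_mul]
      rw [Finset.sum_congr rfl fun l _ => h2 l, Fin.sum_univ_eq_sum_range (fun l : ℕ =>
        if j.val ≤ l then C (c (l - j.val)) * (X ^ (n - 1 - l) * K l) else 0) n,
        ← Finset.sum_filter]
      have h3 : (Finset.range n).filter (fun l => j.val ≤ l) = Finset.Ico j.val n := by
        ext l; simp [and_comm]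
      rw [h3, Finset.sum_Ico_eq_sum_range, show n - 1 - j.val + 1 = n - j.val by omega]
      refine Finset.sum_congr rfl fun e _ => ?_
      rw [Nat.add_sub_cancel_left, Nat.sub_add_eq]
    rw [h1, ← hc, qSeries, if_pos hj, hKg j hj]
    have h4 : ∏ m ∈ Finset.Ico (j.val + 1) n, qFactor w m = K (j + 1) *
        ∏ m ∈ Finset.Ico (j.val + 1) n, (1 + C (r m) * X + C p * X ^ 2) := by
      rw [hKdef, ← Finset.prod_mul_distrib]
      exact Finset.prod_congr rfl fun m hm => hq m (Finset.mem_Ico.1 hm).2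
    rw [h4, hq j hj]
    linear_combination K (j + 1) *
      (∏ m ∈ Finset.Ico (j.val + 1) n, (1 + C (r m) * X + C p * X ^ 2)) * hgk j hj (r j)
  choose c hc0 hc using hexp
  set N : Matrix (Fin n) (Fin n) R :=
    fun l j => (s j + r j) * (if j ≤ l then c j (l.val - j.val) else 0) with hN
  have hdet : N.det = ∏ i : Fin n, ∏ j ∈ Finset.Ici i,
      (w ⟨i, false, false⟩ + w ⟨i, true, false⟩ +
        (w ⟨j, false, true⟩ + w ⟨j, true, true⟩)) := by
    rw [Matrix.det_of_isLowerTriangular]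
    · refine Finset.prod_congr rfl fun i _ => ?_
      have h1 : ∏ j ∈ Finset.Ici i, (w ⟨i, false, false⟩ + w ⟨i, true, false⟩ +
          (w ⟨j, false, true⟩ + w ⟨j, true, true⟩)) =
          ∏ j ∈ Finset.Ici i, (s i.val + r j.val) := by
        refine Finset.prod_congr rfl fun j _ => ?_
        simp only [hs, hr, dif_pos i.isLt, dif_pos j.isLt, Fin.eta]
      have h2 : ∏ j ∈ Finset.Ici i, (s i.val + r j.val) =
          ∏ m ∈ Finset.Ico i.val n, (s i.val + r m) := by
        refine Finset.prod_bij (fun j _ => j.val) ?_ ?_ ?_ fun _ _ => rfl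
        · intro j hj
          exact Finset.mem_Ico.2 ⟨Fin.le_def.1 (Finset.mem_Ici.1 hj), j.isLt⟩
        · intro j _ j' _ h
          exact Fin.ext h
        · intro m hm
          rw [Finset.mem_Ico] at hm
          exact ⟨⟨m, hm.2⟩, Finset.mem_Ici.2 hm.1, rfl⟩
      -- The diagonal entry is `(s i + r i) * c i 0`: the prefactor supplies `m = i`, and `c i 0`
      -- supplies the factors with `m > i`.
      rw [h1, h2, Finset.prod_eq_prod_Ico_succ_bot i.isLt, ← hc0 i]
      simp [hN]
    · intro i j hij
      have hij' : i < j := hij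
      simp [hN, not_le.2 hij']
  rw [← hdet, rowsDet, rowsDet, ← Matrix.det_mul]
  congr 1
  funext i j
  have hi := i.isLt
  rw [Matrix.mul_apply]
  simp only [rowsMatrix, if_pos hi, coeffRows]
  -- The factor `X` in `hc` lowers the degree by one, which is the difference between `lam + delta
  -- n` and `particles n lam`.
  rw [hc j, show (lam + delta n) i = particles n lam i + 1 by
    simp only [Pi.add_apply, delta, particles]; omega, coeff_C_mul, coeff_succ_X_mul, map_sum,
    Finset.mul_sum]
  refine Finset.sum_congr rfl fun l _ => ?_
  rw [coeff_C_mul]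
  simp only [hN]
  ring

theorem sum_QST_eq_mul_prod (w : PrimedLetter n → R) (p : R)
    (hx : ∀ k, w ⟨k, false, false⟩ * w ⟨k, true, false⟩ = p)
    (hy : ∀ k, w ⟨k, false, true⟩ * w ⟨k, true, true⟩ = p)
    (lam : Fin n → ℕ) (hlam : Antitone lam) :
    ∑ S ∈ QST (lam + delta n), ∏ c, w (S c) =
      (∑ T ∈ symplecticTableaux lam, ∏ c, unprimedWeight w (T c)) *
        ∏ i : Fin n, ∏ j ∈ Finset.Ici i,
          (w ⟨i, false, false⟩ + w ⟨i, true, false⟩ +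
            (w ⟨j, false, true⟩ + w ⟨j, true, true⟩)) := by
  rw [sum_symplecticTableaux _ hlam, ← rowsDet_qSeries w p hx hy, sum_QST]
  · intro i j hij _
    have := hlam hij.le
    have := j.isLt
    have hij' : i.val < j.val := hij
    simp only [Pi.add_apply, delta]
    omega
  · intro i
    have := i.isLt
    simp only [Pi.add_apply, delta]
    omega

/-- The conditions on different boxes are independent, so the sum factors over boxes. The box in row
`i` and column `j` admits exactly the four letters `i`, `ī`, `j'`, `j̄'`. -/
theorem sum_QD (w : PrimedLetter n → R) :
    ∑ D ∈ QD n, ∏ c, w (D c) = ∏ i : Fin n, ∏ j ∈ Finset.Ici i,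
      (w ⟨i, false, false⟩ + w ⟨i, true, false⟩ +
        (w ⟨j, false, true⟩ + w ⟨j, true, true⟩)) := by
  have hQD : QD n = Fintype.piFinset fun c : Cell (delta n) =>
      Finset.univ.filter fun a : PrimedLetter n =>
        (a.primed = false → a.idx = c.row) ∧ (a.primed = true → a.idx.val = c.shiftedCol) := by
    ext D
    simp only [QD, Finset.mem_filter, Finset.mem_univ, true_and, Fintype.mem_piFinset]
    exact ⟨fun h c => ⟨h.1 c, h.2 c⟩, fun h => ⟨fun c => (h c).1, fun c => (h c).2⟩⟩
  rw [hQD, ← Finset.prod_univ_sum, Fintype.prod_sigma]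
  refine Finset.prod_congr rfl fun i _ => ?_
  refine Finset.prod_bij (fun l _ => (⟨i.val + l.val, by
    have := l.isLt; simp only [delta] at this; omega⟩ : Fin n)) ?_ ?_ ?_ ?_
  · intro l _
    rw [Finset.mem_Ici, Fin.le_def]
    exact Nat.le_add_right _ _
  · intro l _ l' _ h
    have := congrArg Fin.val h
    simp only at this
    exact Fin.ext (by omega)
  · intro j hj
    have hij : i.val ≤ j.val := Fin.le_def.1 (Finset.mem_Ici.1 hj)
    have := j.isLt
    refine ⟨⟨j.val - i.val, by simp only [delta]; omega⟩, Finset.mem_univ _, Fin.ext ?_⟩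
    simp only
    omega
  · intro l _
    have hl := l.isLt
    simp only [delta] at hl
    set j : Fin n := ⟨i.val + l.val, by omega⟩ with hj
    have hset : (Finset.univ.filter fun a : PrimedLetter n =>
        (a.primed = false → a.idx = Cell.row (a := delta n) ⟨i, l⟩) ∧
          (a.primed = true → a.idx.val = Cell.shiftedCol (a := delta n) ⟨i, l⟩)) =
        {⟨i, false, false⟩, ⟨i, true, false⟩, ⟨j, false, true⟩, ⟨j, true, true⟩} := by
      ext ⟨k, b, q⟩
      cases b <;> cases q <;>
        simp [Cell.row, Cell.shiftedCol, hj, Fin.ext_iff]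
    rw [hset, Finset.sum_insert (by simp), Finset.sum_insert (by simp),
      Finset.sum_insert (by simp), Finset.sum_singleton]
    ring

end Factorization

/-! ### Monomials as products of letter weights -/

section Weights

variable {R : Type*} [CommRing R] {n : ℕ}

theorem prod_ite_eq_pow_occ {G Cl L : Type*} [CommMonoid G] [Fintype Cl] [DecidableEq L]
    (S : Cl → L) (e : L) (g : G) :
    ∏ c, (if S c = e then g else 1) = g ^ (Finset.univ.filter fun c => S c = e).card := by
  rw [Finset.prod_ite, Finset.prod_const, Finset.prod_const_one, mul_one]

/-- Each box contributes a factor `x k` or its inverse according to its letter; exchanging the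
products over boxes and over indices collects the exponents. -/
theorem monomial_sub {x : Fin n → Rˣ} {Cl L : Type} [Fintype Cl] [DecidableEq L]
    (S : Cl → L) (a b : Fin n → L) :
    monomial x (fun k => (occ S (a k) : ℤ) - (occ S (b k) : ℤ)) =
      ∏ c, ((∏ k, (if S c = a k then x k else 1) * (if S c = b k then (x k)⁻¹ else 1) : Rˣ) : R) := by
  rw [monomial, ← Units.coe_prod, Finset.prod_comm]
  congr 1
  refine Finset.prod_congr rfl fun k _ => ?_
  rw [Finset.prod_mul_distrib, prod_ite_eq_pow_occ, prod_ite_eq_pow_occ, zpow_sub, zpow_natCast,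
    zpow_natCast, inv_pow]
  rfl

theorem pow_two_mul_card {Cl : Type*} [Fintype Cl] (t : R) (b : Cl → Bool) :
    t ^ (2 * (Finset.univ.filter fun c => b c = true).card) =
      ∏ c, (if b c = true then t ^ 2 else 1) := by
  rw [Finset.prod_ite, Finset.prod_const, Finset.prod_const_one, mul_one, pow_mul]

/-- The weight of a letter: `x_k`, `t² / x_k`, `y_k`, `t² / y_k` for `k`, `k̄`, `k'`, `k̄'`. -/
def letterWeight (x y : Fin n → Rˣ) (t : R) (a : PrimedLetter n) : R :=
  match a with
  | ⟨k, false, false⟩ => x k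
  | ⟨k, true, false⟩ => t ^ 2 * ((x k)⁻¹ : Rˣ)
  | ⟨k, false, true⟩ => y k
  | ⟨k, true, true⟩ => t ^ 2 * ((y k)⁻¹ : Rˣ)

theorem weight_symplectic {lam : Fin n → ℕ} (x y : Fin n → Rˣ) (t : R) (T : Cell lam → Letter n) :
    t ^ (2 * bar T) * monomial x (wgt T) = ∏ c, unprimedWeight (letterWeight x y t) (T c) := by
  have h := monomial_sub (x := x) T (fun k => ⟨k, false⟩) (fun k => ⟨k, true⟩)
  unfold wgt bar
  rw [h, pow_two_mul_card t fun c => (T c).barred, ← Finset.prod_mul_distrib]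
  refine Finset.prod_congr rfl fun c _ => ?_
  obtain ⟨k, b⟩ := T c
  cases b <;> simp [unprimedWeight, letterWeight, -Units.coe_prod]

theorem weight_primed {mu : Fin n → ℕ} (x y : Fin n → Rˣ) (t : R) (S : Cell mu → PrimedLetter n) :
    t ^ (2 * barP S) * (monomial x (wgtU S) * monomial y (wgtV S)) =
      ∏ c, letterWeight x y t (S c) := by
  have h1 := monomial_sub (x := x) S (fun k => ⟨k, false, false⟩) (fun k => ⟨k, true, false⟩)
  have h2 := monomial_sub (x := y) S (fun k => ⟨k, false, true⟩) (fun k => ⟨k, true, true⟩)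
  unfold wgtU wgtV barP
  rw [h1, h2, pow_two_mul_card t fun c => (S c).barred, ← Finset.prod_mul_distrib,
    ← Finset.prod_mul_distrib]
  refine Finset.prod_congr rfl fun c _ => ?_
  obtain ⟨k, b, q⟩ := S c
  cases b <;> cases q <;> simp [letterWeight, -Units.coe_prod]

end Weights

end SymplecticTableaux

/-! ### The identity in both forms -/

theorem mainTheorem4 {R : Type*} [CommRing R] (n : ℕ) (lam mu : Fin n → ℕ)
    (hlam : Antitone lam) (hmu : mu = lam + SymplecticTableaux.delta n)
    (x y : Fin n → Rˣ) (t : R) :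
    (SymplecticTableaux.Q mu x y t =
      SymplecticTableaux.sp lam x t *
        ∏ i : Fin n, ∏ j ∈ Finset.Ici i,
          ((x i : R) + t ^ 2 * ((x i)⁻¹ : Rˣ) + (y j : R) + t ^ 2 * ((y j)⁻¹ : Rˣ))) ∧
    (∑ S ∈ SymplecticTableaux.QST mu,
        t ^ (2 * SymplecticTableaux.barP S) *
          (SymplecticTableaux.monomial x (SymplecticTableaux.wgtU S) *
            SymplecticTableaux.monomial y (SymplecticTableaux.wgtV S)) =
      (∑ D ∈ SymplecticTableaux.QD n,
        t ^ (2 * SymplecticTableaux.barP D) *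
          (SymplecticTableaux.monomial x (SymplecticTableaux.wgtU D) *
            SymplecticTableaux.monomial y (SymplecticTableaux.wgtV D))) *
      ∑ T ∈ SymplecticTableaux.symplecticTableaux lam,
        t ^ (2 * SymplecticTableaux.bar T) *
          SymplecticTableaux.monomial x (SymplecticTableaux.wgt T)) := by
  -- The weights of a letter and its barred partner multiply to `t ^ 2`, for the `x` and the `y`
  -- variables alike; this is the common `p`.
  have hx : ∀ u : Rˣ, (u : R) * (t ^ 2 * (u⁻¹ : Rˣ)) = t ^ 2 := fun u => by
    rw [mul_left_comm, Units.mul_inv, mul_one]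
  have key := SymplecticTableaux.sum_QST_eq_mul_prod
    (SymplecticTableaux.letterWeight x y t) (t ^ 2) (fun k => hx (x k)) (fun k => hx (y k))
    lam hlam
  subst hmu
  unfold SymplecticTableaux.Q SymplecticTableaux.sp
  simp only [SymplecticTableaux.weight_primed, SymplecticTableaux.weight_symplectic x y]
  rw [key]
  refine ⟨?_, ?_⟩
  · simp only [SymplecticTableaux.letterWeight, add_assoc]
  · rw [SymplecticTableaux.sum_QD, mul_comm]
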